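/- Let $\mathcal H$ be the set of functions $h:[0,1]\to\mathbb R$ of bounded variation with $h(0)=0$. For $h\in\mathcal H$ and a real random variable $Y$ let $$\rho_h(Y)=\int_0^\infty h(\mathbb P(Y>x))\,dx+\int_{-\infty}^0\bigl(h(\mathbb P(Y>x))-h(1)\bigr)\,dx,$$ defined whenever both integrals are finite. Let $h^*$ be the pointwise infimum of all concave $g\in\mathcal H$ with $g\ge h$, and $h_*$ the pointwise supremum of all convex $g\in\mathcal H$ with $g\le h$. Let $\hat h$ (respectively $\check h$) be the function on $[0,1]$ that at every discontinuity point $t\in(0,1)$ of $h$ equals the maximum (respectively the minimum) of $h(t^-),h(t),h(t^+)$, and that equals $h$ at all other points, including $0$ and $1$. For $m\in\mathbb R$, $v>0$, $p>1$ let $q$ be given by $1/p+1/q=1$, and let $\mathcal M^p(m,v)$ be the set of all laws $F_Y$ on $\mathbb R$ with finite first moment, $\mathbb E[Y]=m$ and $\mathbb E[|Y-m|^p]\le v^p$. For concave or convex $g\in\mathcal H$ let $[g]_q=\min_{x\in\mathbb R}\|g'-x\|_{L^q(0,1)}\in[0,\infty]$ if $g$ is continuous on $[0,1]$ and $[g]_q=\infty$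 otherwise. If $[g]_q<\infty$, let $c_{g,q}$ be the minimizer, and if moreover $[g]_q>0$ let $$\phi_g^q(t)=\frac{|g'(1-t)-c_{g,q}|^q}{g'(1-t)-c_{g,q}}\,[g]_q^{1-q}\quad\text{if } g'(1-t)\ne c_{g,q},\qquad \phi_g^q(t)=0\quad\text{otherwise.}$$ **Theorem.** For all $h\in\mathcal H$, $m\in\mathbb R$, $v>0$ and $p>1$, $$\sup_{F_Y\in\mathcal M^p(m,v)}\rho_h(Y)=m\,h(1)+v\,[h^*]_q,\qquad \inf_{F_Y\in\mathcal M^p(m,v)}\rho_h(Y)=m\,h(1)-v\,[h_*]_q,$$ where the supremum and the infimum are taken in $[-\infty,\infty]$ over the $F_Y\in\mathcal M^p(m,v)$ for which $\rho_h(Y)$ is defined. If $h=\hat h$ and $0<[h^*]_q<\infty$, then the supremum is attained, and the left-quantile function of every maximizer is a.e. equal to $m+v\,\phi^q_{h^*}$ on $(0,1)$. If $h=\check h$ and $0<[h_*]_q<\infty$, then the infimum is attained, and the left-quantile function of every minimizer is a.e. equal to $m-v\,\phi^q_{h_*}$ on $(0,1)$. -/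

import Mathlib

open MeasureTheory Set

noncomputable section

namespace DistortionRiskmetric

/-- A distortion function: a real function of bounded variation on `[0,1]` with `h 0 = 0`.
Functions on `[0,1]` are represented by functions on `ℝ`; every notion below depends only on the
values on `[0,1]`. -/
def IsDistortion (h : ℝ → ℝ) : Prop :=
  BoundedVariationOn h (Icc 0 1) ∧ h 0 = 0

/-- The concave envelope `h^*(t) = inf {g t : g a concave distortion function, g ≥ h}`,
for `t ∈ [0,1]`. -/
def concaveEnvelope (h : ℝ → ℝ) (t : ℝ) : ℝ :=
  sInf {y | ∃ g : ℝ → ℝ, IsDistortion g ∧ (∀ s ∈ Icc (0 : ℝ) 1, h s ≤ g s) ∧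
    ConcaveOn ℝ (Icc 0 1) g ∧ y = g t}

/-- The convex envelope `h_*(t) = sup {g t : g a convex distortion function, g ≤ h}`,
for `t ∈ [0,1]`. -/
def convexEnvelope (h : ℝ → ℝ) (t : ℝ) : ℝ :=
  sSup {y | ∃ g : ℝ → ℝ, IsDistortion g ∧ (∀ s ∈ Icc (0 : ℝ) 1, g s ≤ h s) ∧
    ConvexOn ℝ (Icc 0 1) g ∧ y = g t}

/-- The set of discontinuity points of `h` in the open interval `(0,1)`. -/
def jumpSet (h : ℝ → ℝ) : Set ℝ :=
  {t | t ∈ Ioo (0 : ℝ) 1 ∧ (h t ≠ Function.rightLim h t ∨ h t ≠ Function.leftLim h t)}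

open Classical in
/-- The upper semicontinuous modification of `h` (no change at `0` and `1`). -/
def upperMod (h : ℝ → ℝ) (t : ℝ) : ℝ :=
  if t ∈ jumpSet h then max (max (Function.rightLim h t) (Function.leftLim h t)) (h t) else h t

open Classical in
/-- The lower semicontinuous modification of `h` (no change at `0` and `1`). -/
def lowerMod (h : ℝ → ℝ) (t : ℝ) : ℝ :=
  if t ∈ jumpSet h then min (min (Function.rightLim h t) (Function.leftLim h t)) (h t) else h t

/-- Both integrals in the definition of the distortion riskmetric at a random variable `Y` with
law `F` are finite. Here `F.real (Ioi x)` is `ℙ(Y > x)`. -/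
def RiskmetricFinite (h : ℝ → ℝ) (F : Measure ℝ) : Prop :=
  IntegrableOn (fun x => h (F.real (Ioi x))) (Ioi 0) ∧
    IntegrableOn (fun x => h (F.real (Ioi x)) - h 1) (Iio 0)

/-- The distortion riskmetric `ρ_h(Y)` of a random variable `Y` with law `F`. -/
def riskmetric (h : ℝ → ℝ) (F : Measure ℝ) : ℝ :=
  (∫ x in Ioi (0 : ℝ), h (F.real (Ioi x))) + ∫ x in Iio (0 : ℝ), (h (F.real (Ioi x)) - h 1)

/-- The set of laws `F_Y` with finite mean, `E[Y] = m` and `E[|Y - m|^p] ≤ v^p`. -/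
def momentSet (p m v : ℝ) : Set (Measure ℝ) :=
  {F | IsProbabilityMeasure F ∧ Integrable (fun y => y) F ∧ ∫ y, y ∂F = m ∧
    ∫⁻ y, ENNReal.ofReal (|y - m| ^ p) ∂F ≤ ENNReal.ofReal (v ^ p)}

/-- The set of laws in `momentSet p m v` at which the riskmetric is defined. -/
def admissible (h : ℝ → ℝ) (p m v : ℝ) : Set (Measure ℝ) :=
  {F | F ∈ momentSet p m v ∧ RiskmetricFinite h F}

/-- The left-quantile function `inf {x : F(x) ≥ t}` of the law `F`. -/
def quantile (F : Measure ℝ) (t : ℝ) : ℝ :=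
  sInf {x | t ≤ F.real (Iic x)}

/-- `‖g' - x‖_q`, the norm being that of `L^q(0,1)`, with value in `[0,∞]`. -/
def devNorm (g : ℝ → ℝ) (q x : ℝ) : ENNReal :=
  eLpNorm (fun t => deriv g t - x) (ENNReal.ofReal q) (volume.restrict (Ioo 0 1))

/-- The infimum of `‖g' - x‖_q` over `x ∈ ℝ` is attained. -/
theorem exists_devNorm_le (g : ℝ → ℝ) (q : ℝ) (hq : 1 ≤ q) :
    ∃ c, ∀ x, devNorm g q c ≤ devNorm g q x := by
  by_cases htop : ∀ x, devNorm g q x = ⊤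
  · exact ⟨0, fun x => by simp [htop]⟩
  push Not at htop
  obtain ⟨x₀, hx₀⟩ := htop
  have hq1 : (1 : ENNReal) ≤ ENNReal.ofReal q := by simpa using hq
  have hq0 : ENNReal.ofReal q ≠ 0 := fun h => by simp [h] at hq1
  have hμ : (volume.restrict (Ioo (0 : ℝ) 1)) ≠ 0 := by
    intro h
    have := congrArg (fun μ : Measure ℝ => μ univ) h
    simp at this
  have hconst : ∀ a : ℝ, eLpNorm (fun _ : ℝ => a) (ENNReal.ofReal q)
      (volume.restrict (Ioo (0 : ℝ) 1)) = ‖a‖ₑ := by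
    intro a
    rw [eLpNorm_const a hq0 hμ]
    simp
  have hms : ∀ x : ℝ, AEStronglyMeasurable (fun t => deriv g t - x)
      (volume.restrict (Ioo (0 : ℝ) 1)) :=
    fun x => ((measurable_deriv g).sub_const x).aestronglyMeasurable
  have hmc : ∀ a : ℝ, AEStronglyMeasurable (fun _ : ℝ => a)
      (volume.restrict (Ioo (0 : ℝ) 1)) := fun a => aestronglyMeasurable_const
  have tri : ∀ x y, devNorm g q x ≤ devNorm g q y + ‖y - x‖ₑ := by
    intro x y
    have h := eLpNorm_add_le (hms y) (hmc (y - x)) hq1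
    rw [hconst] at h
    refine le_trans (le_of_eq ?_) h
    unfold devNorm
    congr 1
    ext t
    simp
  have hfin : ∀ x, devNorm g q x ≠ ⊤ := fun x =>
    ne_top_of_le_ne_top (ENNReal.add_ne_top.2 ⟨hx₀, by simp⟩) (tri x x₀)
  have triR : ∀ x y, (devNorm g q x).toReal ≤ (devNorm g q y).toReal + |y - x| := by
    intro x y
    have h := ENNReal.toReal_mono (ENNReal.add_ne_top.2 ⟨hfin y, by simp⟩) (tri x y)
    rw [ENNReal.toReal_add (hfin y) (by simp)] at h
    simpa using h
  have coer : ∀ x y, |y - x| ≤ (devNorm g q x).toReal + (devNorm g q y).toReal := by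
    intro x y
    have h := eLpNorm_sub_le (hms x) (hms y) hq1
    have e : ((fun t => deriv g t - x) - fun t => deriv g t - y) = fun _ : ℝ => y - x := by
      ext t
      simp
    rw [e, hconst] at h
    have h' := ENNReal.toReal_mono (ENNReal.add_ne_top.2 ⟨hfin x, hfin y⟩) h
    rw [ENNReal.toReal_add (hfin x) (hfin y)] at h'
    simpa using h'
  have hlip : LipschitzWith 1 (fun x => (devNorm g q x).toReal) := by
    refine LipschitzWith.of_le_add fun x y => ?_
    rw [dist_comm, Real.dist_eq]
    exact triR x y
  obtain ⟨c, hc⟩ := hlip.continuous.exists_forall_le_of_isBounded 0 (by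
    refine (Metric.isBounded_closedBall (x := (0 : ℝ))
      (r := 2 * (devNorm g q 0).toReal)).subset fun x hx => ?_
    have := coer 0 x
    simp only [mem_ofPred_eq] at hx
    simp only [Metric.mem_closedBall, Real.dist_eq]
    linarith)
  exact ⟨c, fun x => (ENNReal.toReal_le_toReal (hfin c) (hfin x)).1 (hc x)⟩

/-- The `q`-center `c_{g,q}`, a minimizer of `x ↦ ‖g' - x‖_q` over `ℝ` (which exists for
`q ≥ 1` by `exists_devNorm_le`). -/
def center (g : ℝ → ℝ) (q : ℝ) : ℝ :=
  Classical.epsilon fun c => ∀ x, devNorm g q c ≤ devNorm g q x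

open Classical in
/-- The `q`-central norm `[g]_q = min_x ‖g' - x‖_q`, set to `∞` if `g` is not continuous
on `[0,1]`. -/
def centralNorm (g : ℝ → ℝ) (q : ℝ) : ENNReal :=
  if ContinuousOn g (Icc 0 1) then ⨅ x : ℝ, devNorm g q x else ⊤

/-- The infimum in `centralNorm` is a minimum, attained at `center g q`. -/
theorem centralNorm_eq (g : ℝ → ℝ) (q : ℝ) (hq : 1 ≤ q) (hg : ContinuousOn g (Icc 0 1)) :
    centralNorm g q = devNorm g q (center g q) := by
  have h := Classical.epsilon_spec (exists_devNorm_le g q hq)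
  rw [centralNorm, if_pos hg]
  exact le_antisymm (iInf_le _ _) (le_iInf h)

open Classical in
/-- The function `φ^q_g`. -/
def phi (g : ℝ → ℝ) (q t : ℝ) : ℝ :=
  if deriv g (1 - t) - center g q ≠ 0 then
    |deriv g (1 - t) - center g q| ^ q / (deriv g (1 - t) - center g q) *
      (centralNorm g q).toReal ^ (1 - q)
  else 0

/-- `F` attains the supremum of `ρ_h` over `momentSet p m v`. -/
def AttainsSup (h : ℝ → ℝ) (p m v : ℝ) (F : Measure ℝ) : Prop :=
  F ∈ admissible h p m v ∧
    (riskmetric h F : EReal) = ⨆ G ∈ admissible h p m v, (riskmetric h G : EReal)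

/-- `F` attains the infimum of `ρ_h` over `momentSet p m v`. -/
def AttainsInf (h : ℝ → ℝ) (p m v : ℝ) (F : Measure ℝ) : Prop :=
  F ∈ admissible h p m v ∧
    (riskmetric h F : EReal) = ⨅ G ∈ admissible h p m v, (riskmetric h G : EReal)

end DistortionRiskmetric

end

noncomputable section

namespace DistortionRiskmetric
open Filter Topology

/-! Let `Z t` be the quantile at `1 - t`. If `g` is concave and continuous with `g 0 = 0` and `g'`
in `L^q`, the layer-cake formula gives `ρ_g = ∫ g' Z` (`IsRearrangement.riskmetric_eq`). As `Z - m`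
has mean zero, this equals `m g(1) + ∫ (g' - c)(Z - m)` for every `c`, and Hölder bounds it by `m
g(1) + v ‖g' - c‖_q`. Equality in Hölder makes `Z - m` a multiple of the signed power `sPow q (g' -
c)`. When `c` is the center, this candidate has mean zero: that is the first-order condition for the
minimum (`integral_sPow_eq_zero`). It is decreasing because `g'` is, so it is the rearranged
quantile function of a law (`optimal_properties`).

For general `h`, `ρ_h ≤ ρ_{h^*}`, because `h ≤ h^*` with equality at `1`. If `h` is upper
semicontinuous on `(0,1)`, `h^*` is affine near every point where `h < h^*` (`exists_affine_of_lt`).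
The optimal `Z` is constant there, so its tail probabilities jump over such points. Hence `ρ_h =
ρ_{h^*}` at the optimal law, and the bound is attained.

Without semicontinuity, keep `h` on a finite grid and lower it elsewhere. The result is upper
semicontinuous, its envelope has bounded slopes, and its optimal law has all tail probabilities on
the grid, so `ρ_h` itself reaches the bound of the gridded function. Along grids that become dense
in the graph of `h` these envelopes increase to `h^*` (`exists_grids_tendsto`), and the central norm
is lower semicontinuous under such limits (`centralNorm_le_of_tendsto`). This yields the supremum,
also when it is infinite. The infimum follows by passing to `-h`. -/

/-! ### Bounded variation of concave functions -/

theorem boundedVariationOn_of_abs_sub_le {f s : ℝ → ℝ} {S : Set ℝ} (hs : BoundedVariationOn s S)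
    (h : ∀ x ∈ S, ∀ y ∈ S, x ≤ y → |f y - f x| ≤ s y - s x) : BoundedVariationOn f S := by
  refine ne_top_of_le_ne_top hs (iSup_le fun p => ?_)
  refine le_trans (Finset.sum_le_sum fun i _ => ?_) (le_iSup (fun p : ℕ × { u : ℕ → ℝ //
    Monotone u ∧ ∀ i, u i ∈ S } => ∑ i ∈ Finset.range p.1,
      edist (s (p.2.1 (i + 1))) (s (p.2.1 i))) p)
  rw [edist_dist, edist_dist, Real.dist_eq, Real.dist_eq]
  exact ENNReal.ofReal_le_ofReal ((h _ (p.2.2.2 i) _ (p.2.2.2 (i + 1))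
    (p.2.2.1 (Nat.le_succ i))).trans (le_abs_self _))

/-- With `u` the running supremum of `f`, increments of `f` never exceed those of `u`. So `2u - f`
is monotone and its increments dominate those of `f` in absolute value. -/
theorem concaveOn_boundedVariationOn {f : ℝ → ℝ} (hf : ConcaveOn ℝ (Icc 0 1) f) {M : ℝ}
    (hM : ∀ t ∈ Icc (0 : ℝ) 1, f t ≤ M) : BoundedVariationOn f (Icc 0 1) := by
  set u : ℝ → ℝ := fun t => sSup (f '' Icc 0 t) with hu
  have bdd : ∀ t ∈ Icc (0 : ℝ) 1, BddAbove (f '' Icc 0 t) := by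
    rintro t ht
    refine ⟨M, ?_⟩
    rintro _ ⟨s, hs, rfl⟩
    exact hM s ⟨hs.1, hs.2.trans ht.2⟩
  have le_u : ∀ t ∈ Icc (0 : ℝ) 1, f t ≤ u t := fun t ht =>
    le_csSup (bdd t ht) ⟨t, ⟨ht.1, le_rfl⟩, rfl⟩
  have u_mono : MonotoneOn u (Icc 0 1) := by
    intro x hx y hy hxy
    exact csSup_le_csSup (bdd y hy) ⟨f x, x, ⟨hx.1, le_rfl⟩, rfl⟩
      (image_mono (Icc_subset_Icc_right hxy))
  have key : ∀ x ∈ Icc (0 : ℝ) 1, ∀ y ∈ Icc (0 : ℝ) 1, x ≤ y → f y - f x ≤ u y - u x := by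
    intro x hx y hy hxy
    rcases le_or_gt (f y) (f x) with h | h
    · have := u_mono hx hy hxy
      linarith
    -- If `f` is larger at `y` than at `x`, concavity forbids a value above `f x` before `x`, so the
    -- running supremum at `x` is `f x`.
    · have hux : u x = f x := by
        refine le_antisymm (csSup_le ⟨f x, x, ⟨hx.1, le_rfl⟩, rfl⟩ ?_) (le_u x hx)
        rintro _ ⟨z, hz, rfl⟩
        have h1 := hf.ge_on_segment (z := x) ⟨hz.1, hz.2.trans hx.2⟩ hy
          (by rw [segment_eq_Icc (hz.2.trans hxy)]; exact ⟨hz.2, hxy⟩)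
        rcases min_le_iff.1 h1 with h2 | h2
        · exact h2
        · exact absurd h2 (not_le.2 h)
      have := le_u y hy
      linarith
  have hs_mono : MonotoneOn (fun t => 2 * u t - f t) (Icc 0 1) := by
    intro x hx y hy hxy
    have h1 := key x hx y hy hxy
    have h2 := u_mono hx hy hxy
    simp only
    linarith
  refine boundedVariationOn_of_abs_sub_le (s := fun t => 2 * u t - f t) ?_ ?_
  · have := hs_mono.locallyBoundedVariationOn 0 1 (by simp) (by simp)
    rwa [inter_self] at this
  · intro x hx y hy hxy
    have h1 := key x hx y hy hxy
    have h2 := u_mono hx hy hxy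
    rw [abs_le]
    constructor <;> linarith

/-! ### The concave envelope and its affine pieces -/

section envelope

variable {h : ℝ → ℝ} {M : ℝ}

/-- The step function which is `0` at `0`, `h 1` at `1` and `C` in between. -/
def capFun (h : ℝ → ℝ) (C t : ℝ) : ℝ := if t = 0 then 0 else if t = 1 then h 1 else C

theorem concaveOn_capFun (h : ℝ → ℝ) {C : ℝ} (hC : 0 ≤ C) (hC1 : h 1 ≤ C) :
    ConcaveOn ℝ (Icc 0 1) (capFun h C) := by
  have hle : ∀ t, capFun h C t ≤ C := by
    intro t
    unfold capFun
    split_ifs <;> linarith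
  refine ⟨convex_Icc 0 1, ?_⟩
  intro x hx y hy a b ha hb hab
  simp only [smul_eq_mul]
  have hax : 0 ≤ a * x := mul_nonneg ha hx.1
  have hby : 0 ≤ b * y := mul_nonneg hb hy.1
  have hax1 : 0 ≤ a * (1 - x) := mul_nonneg ha (by linarith [hx.2])
  have hby1 : 0 ≤ b * (1 - y) := mul_nonneg hb (by linarith [hy.2])
  have hx' := mul_le_mul_of_nonneg_left (hle x) ha
  have hy' := mul_le_mul_of_nonneg_left (hle y) hb
  by_cases h0 : a * x + b * y = 0
  · have e1 : a * capFun h C x = 0 := by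
      rcases mul_eq_zero.1 (show a * x = 0 by linarith) with h | h
      · simp [h]
      · simp [h, capFun]
    have e2 : b * capFun h C y = 0 := by
      rcases mul_eq_zero.1 (show b * y = 0 by linarith) with h | h
      · simp [h]
      · simp [h, capFun]
    rw [e1, e2, h0]
    simp [capFun]
  · by_cases h1 : a * x + b * y = 1
    · have e1 : a * capFun h C x = a * h 1 := by
        rcases mul_eq_zero.1 (show a * (1 - x) = 0 by nlinarith) with h | h
        · simp [h]
        · have : x = 1 := by linarith
          simp [this, capFun]
      have e2 : b * capFun h C y = b * h 1 := by
        rcases mul_eq_zero.1 (show b * (1 - y) = 0 by nlinarith) with h | h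
        · simp [h]
        · have : y = 1 := by linarith
          simp [this, capFun]
      rw [e1, e2, h1, ← add_mul, hab]
      simp [capFun]
    · have : capFun h C (a * x + b * y) = C := by simp [capFun, h0, h1]
      rw [this]
      calc _ ≤ a * C + b * C := by linarith
        _ = C := by rw [← add_mul, hab, one_mul]

theorem envelope_bddBelow {t : ℝ} (ht : t ∈ Icc (0 : ℝ) 1) :
    BddBelow {y | ∃ g : ℝ → ℝ, IsDistortion g ∧ (∀ s ∈ Icc (0 : ℝ) 1, h s ≤ g s) ∧
      ConcaveOn ℝ (Icc 0 1) g ∧ y = g t} := by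
  refine ⟨h t, ?_⟩
  rintro _ ⟨g, -, hg, -, rfl⟩
  exact hg t ht

/-- Bounded variation is automatic for a concave function bounded above, so competitors need no
separate variation estimate. -/
theorem concaveEnvelope_le {g : ℝ → ℝ} (hg : ConcaveOn ℝ (Icc 0 1) g) (hg0 : g 0 = 0)
    (hgM : ∀ t ∈ Icc (0 : ℝ) 1, g t ≤ M) (hhg : ∀ t ∈ Icc (0 : ℝ) 1, h t ≤ g t) {t : ℝ}
    (ht : t ∈ Icc (0 : ℝ) 1) : concaveEnvelope h t ≤ g t :=
  csInf_le (envelope_bddBelow ht) ⟨g, ⟨concaveOn_boundedVariationOn hg hgM, hg0⟩, hhg, hg, rfl⟩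

/-- This competitor makes the envelope finite and pins its values at `0` and `1` to those of `h`;
downward jumps at the end points do not spoil concavity. -/
theorem exists_capFun (h0 : h 0 = 0) (hM : ∀ t ∈ Icc (0 : ℝ) 1, h t ≤ M) :
    ConcaveOn ℝ (Icc 0 1) (capFun h M) ∧ capFun h M 0 = 0 ∧
      (∀ t ∈ Icc (0 : ℝ) 1, capFun h M t ≤ M) ∧ ∀ t ∈ Icc (0 : ℝ) 1, h t ≤ capFun h M t := by
  have hM0 : 0 ≤ M := h0 ▸ hM 0 (by simp)
  have hM1 : h 1 ≤ M := hM 1 (by simp)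
  refine ⟨concaveOn_capFun h hM0 hM1, by simp [capFun], fun t _ => ?_, fun t ht => ?_⟩
  · unfold capFun
    split_ifs <;> linarith
  · have := hM t ht
    unfold capFun
    split_ifs with h1 h2
    · rw [h1, h0]
    · rw [h2]
    · exact this

theorem envelope_nonempty (h0 : h 0 = 0) (hM : ∀ t ∈ Icc (0 : ℝ) 1, h t ≤ M) (t : ℝ) :
    {y | ∃ g : ℝ → ℝ, IsDistortion g ∧ (∀ s ∈ Icc (0 : ℝ) 1, h s ≤ g s) ∧
      ConcaveOn ℝ (Icc 0 1) g ∧ y = g t}.Nonempty := by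
  obtain ⟨h1, h2, h3, h4⟩ := exists_capFun h0 hM
  exact ⟨_, capFun h M, ⟨concaveOn_boundedVariationOn h1 h3, h2⟩, h4, h1, rfl⟩

theorem le_concaveEnvelope (h0 : h 0 = 0) (hM : ∀ t ∈ Icc (0 : ℝ) 1, h t ≤ M) {t : ℝ}
    (ht : t ∈ Icc (0 : ℝ) 1) : h t ≤ concaveEnvelope h t := by
  refine le_csInf (envelope_nonempty h0 hM t) ?_
  rintro _ ⟨g, -, hg, -, rfl⟩
  exact hg t ht

theorem concaveEnvelope_le_bound (h0 : h 0 = 0) (hM : ∀ t ∈ Icc (0 : ℝ) 1, h t ≤ M) {t : ℝ}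
    (ht : t ∈ Icc (0 : ℝ) 1) : concaveEnvelope h t ≤ M := by
  obtain ⟨h1, h2, h3, h4⟩ := exists_capFun h0 hM
  exact (concaveEnvelope_le h1 h2 h3 h4 ht).trans (h3 t ht)

theorem concaveEnvelope_zero (h0 : h 0 = 0) (hM : ∀ t ∈ Icc (0 : ℝ) 1, h t ≤ M) :
    concaveEnvelope h 0 = 0 := by
  obtain ⟨h1, h2, h3, h4⟩ := exists_capFun h0 hM
  exact le_antisymm ((concaveEnvelope_le h1 h2 h3 h4 (by simp)).trans h2.le)
    (h0.symm.le.trans (le_concaveEnvelope h0 hM (by simp)))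

theorem concaveEnvelope_one (h0 : h 0 = 0) (hM : ∀ t ∈ Icc (0 : ℝ) 1, h t ≤ M) :
    concaveEnvelope h 1 = h 1 := by
  obtain ⟨h1, h2, h3, h4⟩ := exists_capFun h0 hM
  exact le_antisymm ((concaveEnvelope_le h1 h2 h3 h4 (by simp)).trans (by simp [capFun]))
    (le_concaveEnvelope h0 hM (by simp))

theorem concaveOn_concaveEnvelope (h0 : h 0 = 0) (hM : ∀ t ∈ Icc (0 : ℝ) 1, h t ≤ M) :
    ConcaveOn ℝ (Icc 0 1) (concaveEnvelope h) := by
  refine ⟨convex_Icc 0 1, ?_⟩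
  intro x hx y hy a b ha hb hab
  refine le_csInf (envelope_nonempty h0 hM _) ?_
  rintro _ ⟨g, hgd, hg, hgc, rfl⟩
  refine le_trans ?_ (hgc.2 hx hy ha hb hab)
  have h1 : concaveEnvelope h x ≤ g x := csInf_le (envelope_bddBelow hx) ⟨g, hgd, hg, hgc, rfl⟩
  have h2 : concaveEnvelope h y ≤ g y := csInf_le (envelope_bddBelow hy) ⟨g, hgd, hg, hgc, rfl⟩
  simp only [smul_eq_mul]
  exact add_le_add (mul_le_mul_of_nonneg_left h1 ha) (mul_le_mul_of_nonneg_left h2 hb)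

/-- The affine function through `(a, g a)` and `(b, g b)`. -/
def chord (g : ℝ → ℝ) (a b t : ℝ) : ℝ := g a + (g b - g a) / (b - a) * (t - a)

theorem chord_le {g : ℝ → ℝ} (hg : ConcaveOn ℝ (Icc 0 1) g) {a b t : ℝ}
    (ha : a ∈ Icc (0 : ℝ) 1) (hb : b ∈ Icc (0 : ℝ) 1) (hab : a < b) (ht : t ∈ Icc a b) :
    chord g a b t ≤ g t := by
  have hba : 0 < b - a := sub_pos.2 hab
  have := hg.2 ha hb (show 0 ≤ (b - t) / (b - a) from div_nonneg (by linarith [ht.2]) hba.le)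
    (show 0 ≤ (t - a) / (b - a) from div_nonneg (by linarith [ht.1]) hba.le)
    (by field_simp; ring)
  simp only [smul_eq_mul] at this
  have e : (b - t) / (b - a) * a + (t - a) / (b - a) * b = t := by field_simp; ring
  rw [e] at this
  refine le_trans (le_of_eq ?_) this
  unfold chord
  field_simp
  ring

theorem le_chord {g : ℝ → ℝ} (hg : ConcaveOn ℝ (Icc 0 1) g) {a b t : ℝ}
    (ha : a ∈ Icc (0 : ℝ) 1) (hb : b ∈ Icc (0 : ℝ) 1) (hab : a < b) (ht : t ∈ Icc (0 : ℝ) 1)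
    (hout : t ≤ a ∨ b ≤ t) : g t ≤ chord g a b t := by
  have hba : 0 < b - a := sub_pos.2 hab
  unfold chord
  rcases hout with h | h
  · rcases h.eq_or_lt with rfl | h
    · simp
    have := hg.slope_anti_adjacent ht hb h hab
    rw [le_div_iff₀ (by linarith)] at this
    linarith
  · rcases h.eq_or_lt with rfl | h
    · rw [div_mul_cancel₀ _ hba.ne']
      linarith
    have := hg.slope_anti_adjacent ha ht hab h
    rw [div_le_iff₀ (by linarith)] at this
    have e : g a + (g b - g a) / (b - a) * (t - a) = g b + (g b - g a) / (b - a) * (t - b) := by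
      field_simp
      ring
    rw [e]
    linarith

theorem concaveOn_chord (g : ℝ → ℝ) (a b : ℝ) : ConcaveOn ℝ (Icc 0 1) (chord g a b) := by
  refine ⟨convex_Icc 0 1, ?_⟩
  intro x _ y _ u w _ _ huw
  unfold chord
  simp only [smul_eq_mul]
  have : w = 1 - u := by linarith
  subst this
  exact le_of_eq (by ring)

/-- Choose `y` strictly between the two values at `s`; near `s`, `h < y < g`. Cutting `g` down to
its chord over a small `[a, b]` leaves a concave majorant of `h`: on `[a, b]` the chord is at least
`y`, and outside it lies above `g`. Minimality of `g` forces it to be the chord. -/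
theorem exists_affine_of_lt (h0 : h 0 = 0) (hM : ∀ t ∈ Icc (0 : ℝ) 1, h t ≤ M)
    (hc : ContinuousOn (concaveEnvelope h) (Icc 0 1)) {s : ℝ} (hs : s ∈ Ioo (0 : ℝ) 1)
    (husc : ∀ y, h s < y → ∀ᶠ t in 𝓝 s, h t < y) (hlt : h s < concaveEnvelope h s) :
    ∃ a b, 0 < a ∧ a < s ∧ s < b ∧ b < 1 ∧
      ∀ t ∈ Icc a b, concaveEnvelope h t = chord (concaveEnvelope h) a b t := by
  set g := concaveEnvelope h with hgdef
  have hgc := concaveOn_concaveEnvelope h0 hM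
  obtain ⟨y, hy1, hy2⟩ := exists_between hlt
  have hcs : ContinuousAt g s := hc.continuousAt (Icc_mem_nhds hs.1 hs.2)
  have hev : ∀ᶠ t in 𝓝 s, h t < y ∧ y < g t ∧ t ∈ Ioo (0 : ℝ) 1 :=
    (husc y hy1).and ((hcs.eventually (lt_mem_nhds hy2)).and (Ioo_mem_nhds hs.1 hs.2))
  obtain ⟨l, u, hlu, hsub⟩ := mem_nhds_iff_exists_Ioo_subset.1 hev
  obtain ⟨a, hla, has⟩ := exists_between hlu.1
  obtain ⟨b, hsb, hbu⟩ := exists_between hlu.2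
  have hIcc : Icc a b ⊆ Ioo l u := fun t ht => ⟨hla.trans_le ht.1, ht.2.trans_lt hbu⟩
  have hab : a < b := has.trans hsb
  have hA := hsub (hIcc ⟨le_rfl, hab.le⟩)
  have hB := hsub (hIcc ⟨hab.le, le_rfl⟩)
  have ha : a ∈ Icc (0 : ℝ) 1 := Ioo_subset_Icc_self hA.2.2
  have hb : b ∈ Icc (0 : ℝ) 1 := Ioo_subset_Icc_self hB.2.2
  refine ⟨a, b, hA.2.2.1, has, hsb, hB.2.2.2, fun t ht => ?_⟩
  have ht01 : t ∈ Icc (0 : ℝ) 1 := ⟨ha.1.trans ht.1, ht.2.trans hb.2⟩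
  have hmin : g t ≤ (g ⊓ chord g a b) t := by
    refine concaveEnvelope_le (M := M) (hgc.inf (concaveOn_chord g a b)) ?_ ?_ ?_ ht01
    · have h1 := concaveEnvelope_zero h0 hM
      have h2 := le_chord hgc ha hb hab (t := 0) (by simp) (Or.inl ha.1)
      rw [← hgdef] at h1 h2
      change min (g 0) (chord g a b 0) = 0
      rw [min_eq_left h2, h1]
    · intro r hr
      exact inf_le_left.trans (concaveEnvelope_le_bound h0 hM hr)
    · intro r hr
      refine le_inf (le_concaveEnvelope h0 hM hr) ?_
      by_cases hrab : r ∈ Icc a b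
      · have h1 : h r < y := (hsub (hIcc hrab)).1
        refine h1.le.trans ?_
        have e : chord g a b r = (b - r) / (b - a) * g a + (r - a) / (b - a) * g b := by
          unfold chord
          have : b - a ≠ 0 := by linarith
          field_simp
          ring
        have hba : 0 < b - a := sub_pos.2 hab
        have c1 : 0 ≤ (b - r) / (b - a) := div_nonneg (by linarith [hrab.2]) hba.le
        have c2 : 0 ≤ (r - a) / (b - a) := div_nonneg (by linarith [hrab.1]) hba.le
        have c3 : (b - r) / (b - a) + (r - a) / (b - a) = 1 := by field_simp; ring
        rw [e]
        calc y = (b - r) / (b - a) * y + (r - a) / (b - a) * y := by rw [← add_mul, c3, one_mul]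
          _ ≤ _ := add_le_add (mul_le_mul_of_nonneg_left hA.2.1.le c1)
            (mul_le_mul_of_nonneg_left hB.2.1.le c2)
      · refine (le_concaveEnvelope h0 hM hr).trans (le_chord hgc ha hb hab hr ?_)
        by_contra hcon
        push Not at hcon
        exact hrab ⟨hcon.1.le, hcon.2.le⟩
  exact le_antisymm (hmin.trans inf_le_right) (chord_le hgc ha hb hab ht)

end envelope

/-- Lebesgue measure on `(0,1)`. -/
abbrev unitMeasure : Measure ℝ := volume.restrict (Ioo 0 1)

instance : IsProbabilityMeasure unitMeasure := ⟨by simp⟩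

/-- The right derivative. -/
def rDeriv (g : ℝ → ℝ) (t : ℝ) : ℝ := derivWithin g (Ioi t) t

/-! ### The right derivative of a concave function -/

section rDeriv

variable {g : ℝ → ℝ}

theorem hasDerivWithinAt_rDeriv (hg : ConcaveOn ℝ (Icc 0 1) g) {t : ℝ} (ht : t ∈ Ioo (0 : ℝ) 1) :
    HasDerivWithinAt g (rDeriv g t) (Ioi t) t := by
  have h := hg.neg.hasDerivWithinAt_rightDeriv_of_mem_interior (x := t) (by rwa [interior_Icc])
  have h2 := h.neg
  rw [neg_neg] at h2
  exact h2.differentiableWithinAt.hasDerivWithinAt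

theorem antitoneOn_rDeriv (hg : ConcaveOn ℝ (Icc 0 1) g) : AntitoneOn (rDeriv g) (Ioo 0 1) := by
  intro x hx y hy hxy
  have h := hg.neg.monotoneOn_rightDeriv (a := x) (b := y) (by rwa [interior_Icc])
    (by rwa [interior_Icc]) hxy
  simp only [derivWithin.neg] at h
  unfold rDeriv
  linarith

theorem ae_differentiableAt (hg : ConcaveOn ℝ (Icc 0 1) g) {M : ℝ}
    (hM : ∀ t ∈ Icc (0 : ℝ) 1, g t ≤ M) : ∀ᵐ t ∂unitMeasure, DifferentiableAt ℝ g t := by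
  rw [ae_restrict_iff' measurableSet_Ioo]
  have hbv := concaveOn_boundedVariationOn hg hM
  rw [← uIcc_of_le (zero_le_one : (0 : ℝ) ≤ 1)] at hbv
  filter_upwards [hbv.ae_differentiableAt_of_mem_uIcc] with t ht h
  exact ht (by rw [uIcc_of_le zero_le_one]; exact Ioo_subset_Icc_self h)

/-- The right derivative is antitone on all of `(0,1)`, whereas `deriv` takes the default value `0`
at kinks; the proofs work with the former. -/
theorem deriv_ae_eq_rDeriv (hg : ConcaveOn ℝ (Icc 0 1) g) {M : ℝ}
    (hM : ∀ t ∈ Icc (0 : ℝ) 1, g t ≤ M) : deriv g =ᵐ[unitMeasure] rDeriv g := by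
  filter_upwards [ae_differentiableAt hg hM] with t ht
  exact (ht.hasDerivAt.hasDerivWithinAt.derivWithin (uniqueDiffWithinAt_Ioi t)).symm

theorem setIntegral_Ioo_rDeriv (hg : ConcaveOn ℝ (Icc 0 1) g) (hc : ContinuousOn g (Icc 0 1))
    (hi : Integrable (rDeriv g) unitMeasure) {a b : ℝ} (ha : 0 ≤ a) (hab : a ≤ b) (hb : b ≤ 1) :
    ∫ t in Ioo a b, rDeriv g t = g b - g a := by
  have := intervalIntegral.integral_eq_sub_of_hasDeriv_right_of_le (f := g) (f' := rDeriv g) hab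
    (hc.mono (Icc_subset_Icc ha hb))
    (fun x hx => hasDerivWithinAt_rDeriv hg ⟨ha.trans_lt hx.1, hx.2.trans_le hb⟩) (by
      rw [intervalIntegrable_iff_integrableOn_Ioo_of_le hab]
      exact IntegrableOn.mono_set hi (Ioo_subset_Ioo ha hb))
  rwa [intervalIntegral.integral_of_le hab, integral_Ioc_eq_integral_Ioo] at this

theorem setIntegral_rDeriv (hg : ConcaveOn ℝ (Icc 0 1) g) (hc : ContinuousOn g (Icc 0 1))
    (hi : Integrable (rDeriv g) unitMeasure) {s : ℝ} (hs : s ∈ Icc (0 : ℝ) 1) :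
    ∫ t in Ioo 0 s, rDeriv g t = g s - g 0 :=
  setIntegral_Ioo_rDeriv hg hc hi le_rfl hs.1 hs.2

theorem slope_le_rDeriv (hg : ConcaveOn ℝ (Icc 0 1) g) {t u : ℝ} (ht : t ∈ Ioo (0 : ℝ) 1)
    (hu : u ∈ Icc (0 : ℝ) 1) (htu : t < u) : (g u - g t) / (u - t) ≤ rDeriv g t := by
  have := hg.slope_le_of_hasDerivWithinAt_Ioi (Ioo_subset_Icc_self ht) hu htu
    (hasDerivWithinAt_rDeriv hg ht)
  rwa [slope_def_field] at this

theorem rDeriv_le_slope (hg : ConcaveOn ℝ (Icc 0 1) g) {t u : ℝ} (ht : t ∈ Ioo (0 : ℝ) 1)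
    (hu : u ∈ Icc (0 : ℝ) 1) (hut : u < t) : rDeriv g t ≤ (g t - g u) / (t - u) := by
  have hlim := (hasDerivWithinAt_iff_tendsto_slope' (by simp)).1 (hasDerivWithinAt_rDeriv hg ht)
  refine le_of_tendsto hlim ?_
  filter_upwards [Ioo_mem_nhdsGT ht.2] with x hx
  have := hg.slope_anti_adjacent hu ⟨ht.1.le.trans hx.1.le, hx.2.le⟩ hut hx.1
  rwa [slope_def_field]

end rDeriv

/-! ### Signed powers and the first-order condition for the center -/

section center

variable {α : Type*} [MeasurableSpace α] {μ : Measure α} [IsFiniteMeasure μ] {f : α → ℝ} {q c : ℝ}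

/-- The signed power `sign y * |y| ^ (q - 1)`. -/
def sPow (q y : ℝ) : ℝ := |y| ^ (q - 2) * y

theorem abs_sPow (hq : 1 < q) (y : ℝ) : |sPow q y| = |y| ^ (q - 1) := by
  rcases eq_or_ne y 0 with rfl | hy
  · simp [sPow, Real.zero_rpow (by linarith : q - 1 ≠ 0)]
  · have : 0 < |y| := abs_pos.2 hy
    rw [sPow, abs_mul, abs_of_nonneg (Real.rpow_nonneg (abs_nonneg y) _),
      ← Real.rpow_add_one this.ne']
    congr 1
    ring

theorem sPow_mul_self (hq : 1 < q) (y : ℝ) : sPow q y * y = |y| ^ q := by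
  rcases eq_or_ne y 0 with rfl | hy
  · simp [sPow, Real.zero_rpow (by linarith : q ≠ 0)]
  · have : 0 < |y| := abs_pos.2 hy
    have e : |y| ^ q = |y| ^ (q - 2) * |y| ^ (2 : ℝ) := by
      rw [← Real.rpow_add this]
      congr 1
      ring
    rw [e, sPow, mul_assoc, Real.rpow_two, sq_abs, sq]

theorem sPow_eq_div (hq : 1 < q) {y : ℝ} (hy : y ≠ 0) : sPow q y = |y| ^ q / y := by
  rw [← sPow_mul_self hq, mul_div_cancel_right₀ _ hy]

theorem sPow_neg (q y : ℝ) : sPow q (-y) = -sPow q y := by simp [sPow]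

theorem sPow_of_nonneg (hq : 1 < q) {y : ℝ} (hy : 0 ≤ y) : sPow q y = y ^ (q - 1) := by
  have h0 : 0 ≤ sPow q y := mul_nonneg (Real.rpow_nonneg (abs_nonneg y) _) hy
  rw [← abs_of_nonneg h0, abs_sPow hq, abs_of_nonneg hy]

theorem monotone_sPow (hq : 1 < q) : Monotone (sPow q) := by
  have hnn : ∀ x y : ℝ, 0 ≤ x → x ≤ y → sPow q x ≤ sPow q y := by
    intro x y hx hxy
    rw [sPow_of_nonneg hq hx, sPow_of_nonneg hq (hx.trans hxy)]
    exact Real.rpow_le_rpow hx hxy (by linarith)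
  have hsign : ∀ x : ℝ, 0 ≤ x → 0 ≤ sPow q x := fun x hx => by
    rw [sPow_of_nonneg hq hx]
    exact Real.rpow_nonneg hx _
  intro x y hxy
  rcases le_total 0 x with hx | hx
  · exact hnn x y hx hxy
  · rcases le_total 0 y with hy | hy
    · have h1 := hsign (-x) (by linarith)
      rw [sPow_neg] at h1
      linarith [hsign y hy]
    · have h1 := hnn (-y) (-x) (by linarith) (by linarith)
      rw [sPow_neg, sPow_neg] at h1
      linarith

theorem measurable_sPow (hq : 1 < q) : Measurable (sPow q) := (monotone_sPow hq).measurable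

theorem integrable_abs_sub_rpow (hq : 1 < q) (hf : MemLp f (ENNReal.ofReal q) μ) (c : ℝ) :
    Integrable (fun a => |f a - c| ^ q) μ := by
  have h := (hf.sub (memLp_const c)).integrable_norm_rpow (by simp; linarith) (by simp)
  rw [ENNReal.toReal_ofReal (by linarith)] at h
  exact h

theorem eLpNorm_eq_ofReal {ν : Measure α} (hq : 1 < q) (hf : MemLp f (ENNReal.ofReal q) ν) :
    eLpNorm f (ENNReal.ofReal q) ν = ENNReal.ofReal ((∫ a, |f a| ^ q ∂ν) ^ q⁻¹) := by
  rw [hf.eLpNorm_eq_integral_rpow_norm (by simp; linarith) (by simp),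
    ENNReal.toReal_ofReal (by linarith)]
  rfl

theorem integral_le_of_eLpNorm_le (hq : 1 < q) (hf : MemLp f (ENNReal.ofReal q) μ) {x : ℝ}
    (h : eLpNorm (fun a => f a - c) (ENNReal.ofReal q) μ ≤
      eLpNorm (fun a => f a - x) (ENNReal.ofReal q) μ) :
    ∫ a, |f a - c| ^ q ∂μ ≤ ∫ a, |f a - x| ^ q ∂μ := by
  have hnn : ∀ x : ℝ, 0 ≤ ∫ a, |f a - x| ^ q ∂μ := fun x =>
    integral_nonneg fun a => Real.rpow_nonneg (abs_nonneg _) _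
  rw [eLpNorm_eq_ofReal (f := fun a => f a - c) hq (hf.sub (memLp_const c)),
    eLpNorm_eq_ofReal (f := fun a => f a - x) hq (hf.sub (memLp_const x)),
    ENNReal.ofReal_le_ofReal_iff (Real.rpow_nonneg (hnn x) _)] at h
  exact (Real.rpow_le_rpow_iff (hnn c) (hnn x) (by positivity)).1 h

/-- The map `x ↦ ∫ |f - x|^q` is differentiable at its minimizer `c`, with derivative `-q ∫ sPow q
(f - c)`. This is what gives the extremal quantile function the mean `m`. -/
theorem integral_sPow_eq_zero (hq : 1 < q) (hf : MemLp f (ENNReal.ofReal q) μ)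
    (hmin : ∀ x, eLpNorm (fun a => f a - c) (ENNReal.ofReal q) μ ≤
      eLpNorm (fun a => f a - x) (ENNReal.ofReal q) μ) :
    ∫ a, sPow q (f a - c) ∂μ = 0 := by
  have hder : ∀ (y x : ℝ), HasDerivAt (fun x => |y - x| ^ q) (-(q * sPow q (y - x))) x := by
    intro y x
    have h1 := (hasDerivAt_abs_rpow (y - x) hq).comp x ((hasDerivAt_id x).const_sub y)
    refine h1.congr_deriv ?_
    unfold sPow
    ring
  have hmeas : ∀ x : ℝ, AEStronglyMeasurable (fun a => f a - x) μ := fun x =>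
    hf.1.sub aestronglyMeasurable_const
  -- For `|x - c| < 1` the derivative is dominated by `q (|f - c| + 1)^q`: the base is at least `1`,
  -- so the exponent `q - 1` may be raised to `q`.
  have hbound := integrable_abs_sub_rpow (f := fun a => |f a - c|) hq
    ((hf.sub (memLp_const c)).norm) (-1)
  have key := hasDerivAt_integral_of_dominated_loc_of_deriv_le (μ := μ)
    (F := fun x a => |f a - x| ^ q) (F' := fun x a => -(q * sPow q (f a - x))) (x₀ := c)
    (s := Metric.ball c 1) (bound := fun a => q * |(|f a - c|) - (-1)| ^ q)
    (Metric.ball_mem_nhds c one_pos)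
    (Eventually.of_forall fun x => (integrable_abs_sub_rpow hq hf x).1)
    (integrable_abs_sub_rpow hq hf c)
    ((((measurable_sPow hq).comp_aemeasurable (hmeas c).aemeasurable).const_mul
      q).neg.aestronglyMeasurable)
    (Eventually.of_forall fun a x hx => ?_) (hbound.const_mul q)
    (Eventually.of_forall fun a x _ => hder (f a) x)
  · have hloc : IsLocalMin (fun x => ∫ a, |f a - x| ^ q ∂μ) c :=
      Eventually.of_forall fun x => integral_le_of_eLpNorm_le hq hf (hmin x)
    have h0 := hloc.hasDerivAt_eq_zero key.2
    rw [integral_neg, integral_const_mul, neg_eq_zero] at h0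
    exact (mul_eq_zero.1 h0).resolve_left (by linarith)
  · rw [norm_neg, norm_mul, Real.norm_of_nonneg (by linarith : 0 ≤ q), Real.norm_eq_abs,
      abs_sPow hq, sub_neg_eq_add, abs_of_nonneg (by positivity : 0 ≤ |f a - c| + 1)]
    refine mul_le_mul_of_nonneg_left ?_ (by linarith)
    have hx' : |x - c| < 1 := by simpa [Real.dist_eq] using hx
    calc |f a - x| ^ (q - 1) ≤ (|f a - c| + 1) ^ (q - 1) := by
          refine Real.rpow_le_rpow (abs_nonneg _) ?_ (by linarith)
          have : f a - x = (f a - c) - (x - c) := by ring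
          rw [this]
          exact (abs_sub _ _).trans (by linarith)
      _ ≤ _ := Real.rpow_le_rpow_of_exponent_le (by linarith [abs_nonneg (f a - c)]) (by linarith)

end center

/-! ### The layer-cake formula for the riskmetric -/

theorem integrable_slice_and_integral {α β : Type*} [MeasurableSpace α] [MeasurableSpace β]
    {ν : Measure α} {μ : Measure β} [SFinite ν] [SFinite μ] {S : Set (α × β)}
    (hS : MeasurableSet S) {k : β → ℝ} (hk : AEStronglyMeasurable k μ)
    (hfin : ∀ t, ν {x | (x, t) ∈ S} ≠ ⊤)
    (hint : Integrable (fun t => k t * ν.real {x | (x, t) ∈ S}) μ) :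
    Integrable (fun x => ∫ t in {t | (x, t) ∈ S}, k t ∂μ) ν ∧
      ∫ x, (∫ t in {t | (x, t) ∈ S}, k t ∂μ) ∂ν = ∫ t, k t * ν.real {x | (x, t) ∈ S} ∂μ := by
  set A : α × β → ℝ := S.indicator fun p => k p.2 with hA
  have hAx : ∀ x, ∫ t, A (x, t) ∂μ = ∫ t in {t | (x, t) ∈ S}, k t ∂μ := fun x => by
    rw [← integral_indicator (show MeasurableSet {t | (x, t) ∈ S} from measurable_prodMk_left hS)]
    rfl
  have hmt : ∀ t, MeasurableSet {x | (x, t) ∈ S} := fun t => measurable_prodMk_right hS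
  have hAt : ∀ t, (fun x => A (x, t)) = {x | (x, t) ∈ S}.indicator fun _ => k t := fun t => rfl
  have hAt1 : ∀ t, ∫ x, A (x, t) ∂ν = k t * ν.real {x | (x, t) ∈ S} := fun t => by
    rw [hAt, integral_indicator (hmt t), setIntegral_const, smul_eq_mul, mul_comm]
  have hAm : AEStronglyMeasurable A (ν.prod μ) := hk.comp_snd.indicator hS
  have hAi : Integrable A (ν.prod μ) := by
    rw [integrable_prod_iff' hAm]
    refine ⟨Eventually.of_forall fun t => ?_, ?_⟩
    · rw [hAt]
      exact (integrable_indicator_iff (hmt t)).2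
        (integrableOn_const (hfin t) enorm_ne_top)
    · refine hint.norm.congr (Eventually.of_forall fun t => ?_)
      have : (fun x => ‖A (x, t)‖) = {x | (x, t) ∈ S}.indicator fun _ => ‖k t‖ := by
        ext x
        rw [congrFun (hAt t) x, norm_indicator_eq_indicator_norm]
      simp only
      rw [this, integral_indicator (hmt t), setIntegral_const, smul_eq_mul, mul_comm, norm_mul,
        Real.norm_of_nonneg measureReal_nonneg, mul_comm]
  have h1 := hAi.integral_prod_left
  have h2 := integral_integral_swap (f := fun x t => A (x, t)) hAi
  simp only [hAx] at h1
  simp only [hAx, hAt1] at h2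
  exact ⟨h1, h2⟩

/-- `Z` is, up to null sets, a decreasing rearrangement `t ↦ F⁻¹(1 - t)` of the quantile function
of `F`. -/
structure IsRearrangement (F : Measure ℝ) (Z : ℝ → ℝ) : Prop where
  aemeasurable : AEMeasurable Z unitMeasure
  superlevel (x : ℝ) : ∀ᵐ t ∂unitMeasure, x < Z t ↔ t < F.real (Ioi x)

section rearrangement

variable {F : Measure ℝ} [IsProbabilityMeasure F] {Z k g : ℝ → ℝ}

theorem unitMeasure_Iio {s : ℝ} (hs : s ∈ Icc (0 : ℝ) 1) :
    unitMeasure (Iio s) = ENNReal.ofReal s := by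
  rw [Measure.restrict_apply measurableSet_Iio]
  have : Iio s ∩ Ioo 0 1 = Ioo 0 s := by
    ext t
    simp only [mem_inter_iff, mem_Iio, mem_Ioo]
    constructor
    · rintro ⟨h1, h2, h3⟩
      exact ⟨h2, h1⟩
    · rintro ⟨h1, h2⟩
      exact ⟨h2, h1, h2.trans_le hs.2⟩
  rw [this, Real.volume_Ioo, sub_zero]

theorem unitMeasure_restrict_Iio {s : ℝ} (hs : s ∈ Icc (0 : ℝ) 1) :
    unitMeasure.restrict (Iio s) = volume.restrict (Ioo 0 s) := by
  rw [Measure.restrict_restrict measurableSet_Iio]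
  congr 1
  ext t
  simp only [mem_inter_iff, mem_Iio, mem_Ioo]
  constructor
  · rintro ⟨h1, h2, h3⟩
    exact ⟨h2, h1⟩
  · rintro ⟨h1, h2⟩
    exact ⟨h2, h1, h2.trans_le hs.2⟩

theorem real_mem_Icc (s : Set ℝ) : F.real s ∈ Icc (0 : ℝ) 1 :=
  ⟨measureReal_nonneg, measureReal_le_one⟩

theorem IsRearrangement.map_eq (hZ : IsRearrangement F Z) : unitMeasure.map Z = F := by
  have := Measure.isProbabilityMeasure_map (μ := unitMeasure) hZ.aemeasurable
  have hIoi : ∀ x, (unitMeasure.map Z) (Ioi x) = F (Ioi x) := by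
    intro x
    rw [Measure.map_apply_of_aemeasurable hZ.aemeasurable measurableSet_Ioi,
      measure_congr (show Z ⁻¹' Ioi x =ᵐ[unitMeasure] Iio (F.real (Ioi x)) from
        (hZ.superlevel x).mono fun t ht => propext ht),
      unitMeasure_Iio (real_mem_Icc _), ofReal_measureReal]
  refine Measure.ext_of_Iic _ _ fun x => ?_
  rw [← compl_Ioi, prob_compl_eq_one_sub measurableSet_Ioi, prob_compl_eq_one_sub measurableSet_Ioi,
    hIoi]

/-- The set `{Z > x}` is a.e. the initial segment of length `ℙ(Y > x)`, so `g (ℙ(Y > x))` is the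
integral of `k` over it, and `g 1` minus this is the integral over `{Z ≤ x}`. Fubini over `x > 0`
and over `x < 0` gives the integrals of `k` against the positive and negative parts of `Z`. The
measurable version `W` of `Z` makes the sets in the product measurable. -/
theorem IsRearrangement.riskmetric_eq (hZ : IsRearrangement F Z) (hk : Integrable k unitMeasure)
    (hkZ : Integrable (fun t => k t * Z t) unitMeasure)
    (hg : ∀ s ∈ Icc (0 : ℝ) 1, g s = ∫ t in Ioo 0 s, k t) :
    RiskmetricFinite g F ∧ riskmetric g F = ∫ t, k t * Z t ∂unitMeasure := by
  obtain ⟨W, hWm, hWZ⟩ := hZ.aemeasurable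
  have hkW : Integrable (fun t => k t * W t) unitMeasure :=
    hkZ.congr (hWZ.mono fun t ht => by simp only [ht])
  have hkWp : Integrable (fun t => k t * max (W t) 0) unitMeasure := by
    refine hkW.mono (hk.1.mul (hWm.max measurable_const).aestronglyMeasurable)
      (Eventually.of_forall fun t => ?_)
    rw [norm_mul, norm_mul]
    refine mul_le_mul_of_nonneg_left ?_ (norm_nonneg _)
    rw [Real.norm_of_nonneg (le_max_right _ _)]
    exact max_le (Real.le_norm_self _) (norm_nonneg _)
  have hkWn : Integrable (fun t => k t * max (-W t) 0) unitMeasure := by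
    refine hkW.mono (hk.1.mul (hWm.neg.max measurable_const).aestronglyMeasurable)
      (Eventually.of_forall fun t => ?_)
    rw [norm_mul, norm_mul]
    refine mul_le_mul_of_nonneg_left ?_ (norm_nonneg _)
    rw [Real.norm_of_nonneg (le_max_right _ _)]
    exact max_le (by rw [← norm_neg]; exact Real.le_norm_self _) (norm_nonneg _)
  have hset : ∀ x, {t | x < W t} =ᵐ[unitMeasure] Iio (F.real (Ioi x)) := fun x => by
    filter_upwards [hWZ, hZ.superlevel x] with t h1 h2
    rw [h1] at h2
    exact propext h2
  have hlow : ∀ x, ∫ t in {t | x < W t}, k t ∂unitMeasure = g (F.real (Ioi x)) := fun x => by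
    rw [setIntegral_congr_set (hset x), unitMeasure_restrict_Iio (real_mem_Icc _),
      hg _ (real_mem_Icc _)]
  have hhigh : ∀ x, ∫ t in {t | W t ≤ x}, k t ∂unitMeasure = g 1 - g (F.real (Ioi x)) := fun x => by
    have hc : {t | W t ≤ x} = {t | x < W t}ᶜ := by
      ext t
      simp
    have hm : MeasurableSet {t | x < W t} := measurableSet_lt measurable_const hWm
    have := integral_add_compl hm hk
    rw [hlow, ← hc] at this
    rw [hg 1 (by simp)]
    linarith
  have hvp : ∀ t, (volume.restrict (Ioi (0 : ℝ))) {x | x < W t} = ENNReal.ofReal (W t) := by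
    intro t
    rw [Measure.restrict_apply (show MeasurableSet {x | x < W t} from measurableSet_Iio)]
    have : {x | x < W t} ∩ Ioi 0 = Ioo 0 (W t) := by
      ext x
      simp [and_comm]
    rw [this, Real.volume_Ioo, sub_zero]
  have hvn : ∀ t, (volume.restrict (Iio (0 : ℝ))) {x | W t ≤ x} = ENNReal.ofReal (-W t) := by
    intro t
    rw [Measure.restrict_apply (show MeasurableSet {x | W t ≤ x} from measurableSet_Ici)]
    have : {x | W t ≤ x} ∩ Iio 0 = Ico (W t) 0 := by
      ext x
      simp
    rw [this, Real.volume_Ico, zero_sub]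
  have hvpr : ∀ t, (volume.restrict (Ioi (0 : ℝ))).real {x | x < W t} = max (W t) 0 := fun t => by
    rw [measureReal_def, hvp, ENNReal.toReal_ofReal']
  have hvnr : ∀ t, (volume.restrict (Iio (0 : ℝ))).real {x | W t ≤ x} = max (-W t) 0 := fun t => by
    rw [measureReal_def, hvn, ENNReal.toReal_ofReal']
  have hP := integrable_slice_and_integral (ν := volume.restrict (Ioi (0 : ℝ))) (μ := unitMeasure)
    (S := {p : ℝ × ℝ | p.1 < W p.2}) (measurableSet_lt measurable_fst (hWm.comp measurable_snd))
    hk.1 (fun t => by simp only [mem_ofPred_eq, hvp]; exact ENNReal.ofReal_ne_top)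
    (by simpa only [mem_ofPred_eq, hvpr] using hkWp)
  have hN := integrable_slice_and_integral (ν := volume.restrict (Iio (0 : ℝ))) (μ := unitMeasure)
    (S := {p : ℝ × ℝ | W p.2 ≤ p.1}) (measurableSet_le (hWm.comp measurable_snd) measurable_fst)
    hk.1 (fun t => by simp only [mem_ofPred_eq, hvn]; exact ENNReal.ofReal_ne_top)
    (by simpa only [mem_ofPred_eq, hvnr] using hkWn)
  simp only [mem_ofPred_eq, hvpr, hlow] at hP
  simp only [mem_ofPred_eq, hvnr, hhigh] at hN
  have hneg : (fun x => g (F.real (Ioi x)) - g 1) = fun x => -(g 1 - g (F.real (Ioi x))) := by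
    ext x
    ring
  refine ⟨⟨hP.1, ?_⟩, ?_⟩
  · unfold IntegrableOn
    rw [hneg]
    exact hN.1.neg
  · unfold riskmetric
    rw [hneg, integral_neg, hP.2, hN.2, ← sub_eq_add_neg, ← integral_sub hkWp hkWn]
    refine integral_congr_ae (hWZ.mono fun t ht => ?_)
    simp only [ht]
    rw [← mul_sub]
    congr 1
    rcases le_total (W t) 0 with h | h
    · rw [max_eq_right h, max_eq_left (by linarith)]
      ring
    · rw [max_eq_left h, max_eq_right (by linarith)]
      ring

end rearrangement

/-! ### The quantile function as a decreasing rearrangement -/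

section quantile

variable {F : Measure ℝ} [IsProbabilityMeasure F]

/-- Right continuity of the distribution function makes the infimum in `quantile` attained, which
gives the reverse implication. -/
theorem le_real_Iic_iff {t : ℝ} (ht : t ∈ Ioo (0 : ℝ) 1) (x : ℝ) :
    t ≤ F.real (Iic x) ↔ quantile F t ≤ x := by
  have hmono : Monotone fun x => F.real (Iic x) := fun a b hab =>
    measureReal_mono (Iic_subset_Iic.2 hab)
  have hcdf : ∀ x, F.real (Iic x) = ProbabilityTheory.cdf F x := fun x =>
    (ProbabilityTheory.cdf_eq_real F x).symm
  have hbot : ∃ y, F.real (Iic y) < t := by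
    have := (ProbabilityTheory.tendsto_cdf_atBot F).eventually (gt_mem_nhds ht.1)
    obtain ⟨y, hy⟩ := this.exists
    exact ⟨y, by rwa [hcdf]⟩
  have htop : ∃ y, t < F.real (Iic y) := by
    have := (ProbabilityTheory.tendsto_cdf_atTop F).eventually (lt_mem_nhds ht.2)
    obtain ⟨y, hy⟩ := this.exists
    exact ⟨y, by rwa [hcdf]⟩
  obtain ⟨y, hy⟩ := hbot
  have hbdd : BddBelow {x | t ≤ F.real (Iic x)} := by
    refine ⟨y, fun z hz => ?_⟩
    by_contra hlt
    exact absurd (hz.trans (hmono (not_le.1 hlt).le)) (not_le.2 hy)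
  have hne : {x | t ≤ F.real (Iic x)}.Nonempty := htop.imp fun _ h => h.le
  refine ⟨fun h => csInf_le hbdd h, fun h => ?_⟩
  have hright : Tendsto (fun y => F.real (Iic y)) (𝓝[>] x) (𝓝 (F.real (Iic x))) := by
    have h1 := (ProbabilityTheory.cdf F).right_continuous x
    have h2 := h1.tendsto.mono_left (nhdsWithin_mono x Ioi_subset_Ici_self)
    simpa only [hcdf] using h2
  refine ge_of_tendsto hright ?_
  filter_upwards [self_mem_nhdsWithin] with z hz
  obtain ⟨w, hw, hwz⟩ := exists_lt_of_csInf_lt hne (lt_of_le_of_lt h hz)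
  exact le_trans hw (hmono hwz.le)

theorem quantile_monotoneOn : MonotoneOn (quantile F) (Ioo 0 1) := by
  intro s hs t ht hst
  rw [← le_real_Iic_iff hs]
  exact hst.trans ((le_real_Iic_iff ht _).2 le_rfl)

theorem isRearrangement_quantile : IsRearrangement F fun t => quantile F (1 - t) := by
  refine ⟨aemeasurable_restrict_of_antitoneOn measurableSet_Ioo fun s hs t ht hst => ?_,
    fun x => ?_⟩
  · exact quantile_monotoneOn ⟨by linarith [ht.2], by linarith [ht.1]⟩
      ⟨by linarith [hs.2], by linarith [hs.1]⟩ (by linarith)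
  · rw [ae_restrict_iff' measurableSet_Ioo]
    refine Eventually.of_forall fun t ht => ?_
    rw [← not_iff_not, not_lt, ← le_real_Iic_iff ⟨by linarith [ht.2], by linarith [ht.1]⟩,
      ← compl_Ioi, probReal_compl_eq_one_sub measurableSet_Ioi]
    constructor <;> intro h <;> linarith

end quantile

/-! ### Young's and Hölder's inequalities with equality cases -/

section young

variable {p q : ℝ}

theorem eq_sPow_of_young_eq (hpq : q.HolderConjugate p) {a b : ℝ}
    (h : a * b = |a| ^ q / q + |b| ^ p / p) : b = sPow q a := by
  have hq : 1 < q := hpq.lt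
  have h1 := Real.young_inequality_of_nonneg (abs_nonneg a) (abs_nonneg b) hpq
  have h2 : a * b ≤ |a| * |b| := (le_abs_self _).trans (abs_mul a b).le
  have h3 : |a| * |b| = |a| ^ q / q + |b| ^ p / p := le_antisymm h1 (h ▸ h2)
  have h4 := (Real.young_inequality_eq_iff_of_nonneg (abs_nonneg a) (abs_nonneg b) hpq).1 h3
  rcases eq_or_ne a 0 with rfl | ha
  · rw [abs_zero, Real.zero_rpow hpq.ne_zero, eq_comm,
      Real.rpow_eq_zero (abs_nonneg b) hpq.symm.ne_zero, abs_eq_zero] at h4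
    simp [h4, sPow]
  · have h5 : a * b = |a| ^ q := by
      rw [h, ← h4, div_eq_mul_inv, div_eq_mul_inv, ← mul_add, hpq.inv_add_inv_eq_one, mul_one]
    rw [sPow_eq_div hq ha, ← h5, mul_div_cancel_left₀ _ ha]

variable {α : Type*} [MeasurableSpace α] {μ : Measure α} {f b : α → ℝ} {v : ℝ}

theorem integrable_abs_rpow {f : α → ℝ} (hq : 1 < q) (hf : MemLp f (ENNReal.ofReal q) μ) :
    Integrable (fun a => |f a| ^ q) μ := by
  have h := hf.integrable_norm_rpow (by simp; linarith) (by simp)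
  rwa [ENNReal.toReal_ofReal (by linarith)] at h

theorem integrable_mul_of_memLp (hpq : q.HolderConjugate p) (hf : MemLp f (ENNReal.ofReal q) μ)
    (hb : MemLp b (ENNReal.ofReal p) μ) : Integrable (fun a => f a * b a) μ :=
  have := hpq.ennrealOfReal
  hf.integrable_mul hb

/-- Hölder's inequality for `∫ f b` when `‖b‖_p ≤ v`, with its case of equality. -/
theorem holder_of_le (hpq : q.HolderConjugate p) (hv : 0 < v)
    (hf : MemLp f (ENNReal.ofReal q) μ) (hb : MemLp b (ENNReal.ofReal p) μ)
    (hbv : ∫ a, |b a| ^ p ∂μ ≤ v ^ p) :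
    ∫ a, f a * b a ∂μ ≤ v * (∫ a, |f a| ^ q ∂μ) ^ q⁻¹ ∧
      (0 < (∫ a, |f a| ^ q ∂μ) ^ q⁻¹ → v * (∫ a, |f a| ^ q ∂μ) ^ q⁻¹ ≤ ∫ a, f a * b a ∂μ →
        ∀ᵐ a ∂μ, b a = v * (sPow q (f a) * ((∫ a, |f a| ^ q ∂μ) ^ q⁻¹) ^ (1 - q))) := by
  have hq0 : 0 < q := hpq.pos
  have hp0 : 0 < p := hpq.symm.pos
  set I := ∫ a, |f a| ^ q ∂μ with hI
  have hI0 : 0 ≤ I := integral_nonneg fun a => Real.rpow_nonneg (abs_nonneg _) _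
  set N := I ^ q⁻¹ with hN
  have hNq : N ^ q = I := by rw [hN, ← Real.rpow_mul hI0, inv_mul_cancel₀ hq0.ne', Real.rpow_one]
  have hfi := integrable_abs_rpow hpq.lt hf
  have hbi := integrable_abs_rpow hpq.symm.lt hb
  have hfb := integrable_mul_of_memLp hpq hf hb
  rcases (Real.rpow_nonneg hI0 q⁻¹).eq_or_lt with h0 | hNpos
  -- If `N = 0` then `f = 0` a.e., so the integral vanishes; the equality statement is vacuous.
  · have hI00 : I = 0 := by rw [← hNq, hN, ← h0, Real.zero_rpow hq0.ne']
    have hz := (integral_eq_zero_iff_of_nonneg (fun a => Real.rpow_nonneg (abs_nonneg _) _)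
      hfi).1 hI00
    have hz' : (fun a => f a * b a) =ᵐ[μ] fun _ => 0 := by
      filter_upwards [hz] with a ha
      have := (Real.rpow_eq_zero (abs_nonneg (f a)) hq0.ne').1 ha
      rw [abs_eq_zero.1 this, zero_mul]
    rw [integral_congr_ae hz', integral_zero]
    refine ⟨mul_nonneg hv.le (h0.le.trans_eq hN.symm), fun h => absurd h ?_⟩
    rw [hN, ← h0]
    exact lt_irrefl 0
  · rw [← hN] at hNpos
    -- The deficit in Young's inequality for the normalized functions. Its integral is nonnegative
    -- and at most `1 - (∫ f b) / (N v)`: this is Hölder, and equality there forces `D = 0` a.e.,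
    -- the equality case of Young.
    set D : α → ℝ := fun a => |f a / N| ^ q / q + |b a / v| ^ p / p - f a / N * (b a / v) with hD
    have hDnn : ∀ a, 0 ≤ D a := fun a => sub_nonneg.2 (Real.young_inequality _ _ hpq)
    have hDe : D = fun a => |f a| ^ q * (N ^ q * q)⁻¹ + |b a| ^ p * (v ^ p * p)⁻¹ -
        (f a * b a) * (N * v)⁻¹ := by
      ext a
      rw [hD]
      simp only
      rw [abs_div, abs_div, abs_of_pos hNpos, abs_of_pos hv,
        Real.div_rpow (abs_nonneg _) hNpos.le, Real.div_rpow (abs_nonneg _) hv.le]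
      field_simp
    have hDi : Integrable D μ := by
      rw [hDe]
      exact ((hfi.mul_const _).add (hbi.mul_const _)).sub (hfb.mul_const _)
    have hvp : 0 < v ^ p := Real.rpow_pos_of_pos hv p
    have hIpos : 0 < I := by rw [← hNq]; exact Real.rpow_pos_of_pos hNpos q
    have hDint : ∫ a, D a ∂μ = q⁻¹ + (∫ a, |b a| ^ p ∂μ) * (v ^ p * p)⁻¹ -
        (∫ a, f a * b a ∂μ) * (N * v)⁻¹ := by
      rw [hDe, integral_sub, integral_add, integral_mul_const, integral_mul_const,
        integral_mul_const, ← hI, hNq]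
      · congr 2
        field_simp
      · exact hfi.mul_const _
      · exact hbi.mul_const _
      · exact (hfi.mul_const _).add (hbi.mul_const _)
      · exact hfb.mul_const _
    have hb1 : (∫ a, |b a| ^ p ∂μ) * (v ^ p * p)⁻¹ ≤ p⁻¹ := by
      rw [mul_inv, ← mul_assoc, ← div_eq_mul_inv]
      exact mul_le_of_le_one_left (by positivity) ((div_le_one hvp).2 hbv)
    have hsum := hpq.inv_add_inv_eq_one
    constructor
    · have := integral_nonneg (μ := μ) (show 0 ≤ D from hDnn)
      rw [hDint] at this
      have h1 : (∫ a, f a * b a ∂μ) * (N * v)⁻¹ ≤ 1 := by linarith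
      rw [← div_eq_mul_inv, div_le_one (by positivity)] at h1
      linarith
    · intro _ hle
      have h1 : 1 ≤ (∫ a, f a * b a ∂μ) * (N * v)⁻¹ := by
        rw [← div_eq_mul_inv, one_le_div (by positivity)]
        linarith
      have hD0 : ∫ a, D a ∂μ = 0 := le_antisymm (by rw [hDint]; linarith)
        (integral_nonneg fun a => hDnn a)
      have hz := (integral_eq_zero_iff_of_nonneg hDnn hDi).1 hD0
      filter_upwards [hz] with a ha
      have h2 : f a / N * (b a / v) = |f a / N| ^ q / q + |b a / v| ^ p / p := by
        have : D a = 0 := ha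
        simp only [hD] at this
        linarith
      have h3 := eq_sPow_of_young_eq hpq h2
      rw [div_eq_iff hv.ne'] at h3
      rw [h3, mul_comm]
      congr 1
      unfold sPow
      rw [abs_div, abs_of_pos hNpos, Real.div_rpow (abs_nonneg _) hNpos.le,
        show (1 - q) = -(q - 2) - 1 by ring, Real.rpow_sub_one hNpos.ne', Real.rpow_neg hNpos.le]
      have : N ^ (q - 2) ≠ 0 := (Real.rpow_pos_of_pos hNpos _).ne'
      field_simp

end young

/-! ### Laws of decreasing functions on the unit interval -/

section antitone

variable {Z : ℝ → ℝ}

/-- The set `{Z > x}` is an initial segment of `(0,1)` whose length is the tail probability; only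
membership of its right end point is undecided. -/
theorem antitone_superlevel (hZ : AntitoneOn Z (Ioo 0 1)) {x t : ℝ} (ht : t ∈ Ioo (0 : ℝ) 1)
    (hne : t ≠ (unitMeasure.map Z).real (Ioi x)) :
    x < Z t ↔ t < (unitMeasure.map Z).real (Ioi x) := by
  have hm : AEMeasurable Z unitMeasure := aemeasurable_restrict_of_antitoneOn measurableSet_Ioo hZ
  have hs : (unitMeasure.map Z).real (Ioi x) = volume.real (Z ⁻¹' Ioi x ∩ Ioo 0 1) := by
    rw [Measure.real, Measure.map_apply_of_aemeasurable hm measurableSet_Ioi,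
      Measure.restrict_apply' measurableSet_Ioo]
    rfl
  rw [hs] at hne ⊢
  have hfin : volume (Z ⁻¹' Ioi x ∩ Ioo 0 1) ≠ ⊤ :=
    ne_top_of_le_ne_top (by simp) (measure_mono inter_subset_right : _ ≤ volume (Ioo (0 : ℝ) 1))
  constructor
  · intro hx
    refine lt_of_le_of_ne ?_ hne
    have : Ioo 0 t ⊆ Z ⁻¹' Ioi x ∩ Ioo 0 1 := fun u hu =>
      ⟨lt_of_lt_of_le hx (hZ ⟨hu.1, hu.2.trans ht.2⟩ ht hu.2.le), hu.1, hu.2.trans ht.2⟩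
    have h1 := measureReal_mono this hfin
    rwa [Real.volume_real_Ioo_of_le ht.1.le, sub_zero] at h1
  · intro hlt
    by_contra hx
    have : Z ⁻¹' Ioi x ∩ Ioo 0 1 ⊆ Ioo 0 t := by
      rintro u ⟨hu1, hu2⟩
      refine ⟨hu2.1, ?_⟩
      by_contra hcon
      exact hx (lt_of_lt_of_le hu1 (hZ ht hu2 (not_lt.1 hcon)))
    have h1 := measureReal_mono (μ := volume) this (by simp)
    rw [Real.volume_real_Ioo_of_le ht.1.le, sub_zero] at h1
    linarith

theorem isRearrangement_of_antitoneOn (hZ : AntitoneOn Z (Ioo 0 1)) :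
    IsRearrangement (unitMeasure.map Z) Z := by
  refine ⟨aemeasurable_restrict_of_antitoneOn measurableSet_Ioo hZ, fun x => ?_⟩
  have h1 : ∀ᵐ t ∂unitMeasure, t ≠ (unitMeasure.map Z).real (Ioi x) :=
    Measure.ae_ne _ _
  filter_upwards [h1, ae_restrict_mem measurableSet_Ioo] with t ht1 ht2
  exact antitone_superlevel hZ ht2 ht1

/-- A tail probability inside `(a, b)` would put `Z` above `x` just to its left and not above `x`
just to its right. The atom at `C` makes the tail function jump across the interval. -/
theorem real_Ioi_notMem_of_const (hZ : AntitoneOn Z (Ioo 0 1)) {a b C : ℝ} (ha : 0 < a) (hb : b < 1)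
    (hC : ∀ t ∈ Ioo a b, Z t = C) (x : ℝ) : (unitMeasure.map Z).real (Ioi x) ∉ Ioo a b := by
  intro hs
  obtain ⟨t, ht1, ht2⟩ := exists_between hs.1
  obtain ⟨u, hu1, hu2⟩ := exists_between hs.2
  have h1 := antitone_superlevel hZ (x := x) ⟨ha.trans ht1, (ht2.trans hs.2).trans hb⟩ ht2.ne
  have h2 := antitone_superlevel hZ (x := x) ⟨ha.trans (hs.1.trans hu1), hu2.trans hb⟩ hu1.ne'
  rw [hC t ⟨ht1, ht2.trans hs.2⟩] at h1
  rw [hC u ⟨hs.1.trans hu1, hu2⟩] at h2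
  exact absurd (h2.1 (h1.2 ht2)) (not_lt.2 hu1.le)

end antitone

/-! ### Moment constraints in terms of rearrangements -/

section moments

variable {F : Measure ℝ} {Z : ℝ → ℝ} {p m v : ℝ}

theorem moments_of_mem (hp : 1 < p) (hv : 0 < v) (hF : F ∈ momentSet p m v)
    (hZ : AEMeasurable Z unitMeasure) (hmap : unitMeasure.map Z = F) :
    MemLp (fun t => Z t - m) (ENNReal.ofReal p) unitMeasure ∧ ∫ t, (Z t - m) ∂unitMeasure = 0 ∧
      ∫ t, |Z t - m| ^ p ∂unitMeasure ≤ v ^ p := by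
  obtain ⟨hprob, hint, hmean, hmom⟩ := hF
  subst hmap
  have hZi : Integrable Z unitMeasure := (integrable_map_measure (by fun_prop) hZ).1 hint
  rw [integral_map hZ (by fun_prop)] at hmean
  rw [lintegral_map' (by fun_prop) hZ] at hmom
  have hsm : AEStronglyMeasurable (fun t => Z t - m) unitMeasure :=
    (hZ.sub_const m).aestronglyMeasurable
  have hnn : ∀ t, 0 ≤ |Z t - m| ^ p := fun t => Real.rpow_nonneg (abs_nonneg _) _
  have hmem : MemLp (fun t => Z t - m) (ENNReal.ofReal p) unitMeasure := by
    refine ⟨hsm, ?_⟩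
    rw [eLpNorm_lt_top_iff_lintegral_rpow_enorm_lt_top (by simp; linarith) (by simp),
      ENNReal.toReal_ofReal (by linarith)]
    refine lt_of_le_of_lt (le_of_eq_of_le ?_ hmom) ENNReal.ofReal_lt_top
    refine lintegral_congr fun t => ?_
    rw [Real.enorm_eq_ofReal_abs, ENNReal.ofReal_rpow_of_nonneg (abs_nonneg _) (by linarith)]
  refine ⟨hmem, ?_, ?_⟩
  · rw [integral_sub hZi (integrable_const m), hmean]
    simp
  · rw [← ofReal_integral_eq_lintegral_ofReal (integrable_abs_rpow hp hmem)
      (Eventually.of_forall hnn)] at hmom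
    exact (ENNReal.ofReal_le_ofReal_iff (by positivity)).1 hmom

theorem map_mem_momentSet (hp : 1 < p) (hZ : MemLp Z (ENNReal.ofReal p) unitMeasure)
    (hmean : ∫ t, Z t ∂unitMeasure = m) (hmom : ∫ t, |Z t - m| ^ p ∂unitMeasure ≤ v ^ p) :
    unitMeasure.map Z ∈ momentSet p m v := by
  have hZm := hZ.1.aemeasurable
  refine ⟨Measure.isProbabilityMeasure_map hZm, ?_, ?_, ?_⟩
  · rw [integrable_map_measure (by fun_prop) hZm]
    exact hZ.integrable (by simpa using hp.le)
  · rwa [integral_map hZm (by fun_prop)]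
  · rw [lintegral_map' (by fun_prop) hZm, ← ofReal_integral_eq_lintegral_ofReal
      (integrable_abs_rpow (f := fun t => Z t - m) hp (hZ.sub (memLp_const m)))
      (Eventually.of_forall fun t => Real.rpow_nonneg (abs_nonneg _) _)]
    exact ENNReal.ofReal_le_ofReal hmom

end moments

/-! ### The extremal law for a concave distortion function -/

section concave

variable {g : ℝ → ℝ} {M p q c m v : ℝ}

theorem memLp_rDeriv (hg : ConcaveOn ℝ (Icc 0 1) g) (hM : ∀ t ∈ Icc (0 : ℝ) 1, g t ≤ M)
    (hfin : devNorm g q c ≠ ⊤) : MemLp (rDeriv g) (ENNReal.ofReal q) unitMeasure := by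
  have h1 : MemLp (fun t => deriv g t - c) (ENNReal.ofReal q) unitMeasure :=
    ⟨((measurable_deriv g).sub_const c).aestronglyMeasurable, lt_top_iff_ne_top.2 hfin⟩
  refine MemLp.ae_eq ?_ (h1.add (memLp_const c))
  filter_upwards [deriv_ae_eq_rDeriv hg hM] with t ht
  simp [ht]

theorem devNorm_eq_rDeriv (hg : ConcaveOn ℝ (Icc 0 1) g) (hM : ∀ t ∈ Icc (0 : ℝ) 1, g t ≤ M)
    (x : ℝ) : devNorm g q x = eLpNorm (fun t => rDeriv g t - x) (ENNReal.ofReal q) unitMeasure := by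
  refine eLpNorm_congr_ae ?_
  filter_upwards [deriv_ae_eq_rDeriv hg hM] with t ht
  rw [ht]

theorem toReal_devNorm (hq : 1 < q) (hg : ConcaveOn ℝ (Icc 0 1) g)
    (hM : ∀ t ∈ Icc (0 : ℝ) 1, g t ≤ M) (hfin : devNorm g q c ≠ ⊤) :
    (devNorm g q c).toReal = (∫ t, |rDeriv g t - c| ^ q ∂unitMeasure) ^ q⁻¹ := by
  rw [devNorm_eq_rDeriv hg hM, eLpNorm_eq_ofReal (f := fun t => rDeriv g t - c) hq
    ((memLp_rDeriv hg hM hfin).sub (memLp_const c)), ENNReal.toReal_ofReal]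
  exact Real.rpow_nonneg (integral_nonneg fun t => Real.rpow_nonneg (abs_nonneg _) _) _

/-- Any constant `c` may be subtracted from the derivative because `Z - m` has mean zero. -/
theorem riskmetric_eq_of_rearrangement (hpq : q.HolderConjugate p) (hg : ConcaveOn ℝ (Icc 0 1) g)
    (hc : ContinuousOn g (Icc 0 1)) (h0 : g 0 = 0)
    (hk : MemLp (rDeriv g) (ENNReal.ofReal q) unitMeasure) {F : Measure ℝ} [IsProbabilityMeasure F]
    {Z : ℝ → ℝ} (hZ : IsRearrangement F Z)
    (hZp : MemLp (fun t => Z t - m) (ENNReal.ofReal p) unitMeasure)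
    (hZm : ∫ t, (Z t - m) ∂unitMeasure = 0) (c : ℝ) :
    RiskmetricFinite g F ∧
      riskmetric g F = m * g 1 + ∫ t, (rDeriv g t - c) * (Z t - m) ∂unitMeasure := by
  have hki : Integrable (rDeriv g) unitMeasure := hk.integrable (by simpa using hpq.lt.le)
  have hZi : Integrable (fun t => Z t - m) unitMeasure :=
    hZp.integrable (by simpa using hpq.symm.lt.le)
  have hkZ := integrable_mul_of_memLp hpq hk hZp
  have hkZ' : Integrable (fun t => rDeriv g t * Z t) unitMeasure := by
    refine (hkZ.add (hki.mul_const m)).congr (Eventually.of_forall fun t => ?_)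
    simp only [Pi.add_apply]
    ring
  have hgs : ∀ s ∈ Icc (0 : ℝ) 1, g s = ∫ t in Ioo 0 s, rDeriv g t := fun s hs => by
    rw [setIntegral_rDeriv hg hc hki hs, h0, sub_zero]
  obtain ⟨h1, h2⟩ := hZ.riskmetric_eq hki hkZ' hgs
  refine ⟨h1, ?_⟩
  have e : (fun t => rDeriv g t * Z t) = fun t => (rDeriv g t - c) * (Z t - m) +
      (rDeriv g t * m + c * (Z t - m)) := by
    ext t
    ring
  have e2 : Integrable (fun t => (rDeriv g t - c) * (Z t - m)) unitMeasure :=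
    integrable_mul_of_memLp hpq (hk.sub (memLp_const c)) hZp
  have e3 : Integrable (fun t => rDeriv g t * m + c * (Z t - m)) unitMeasure :=
    (hki.mul_const m).add (hZi.const_mul c)
  rw [h2, e, integral_add e2 e3,
    integral_add (hki.mul_const m) (hZi.const_mul c), integral_mul_const, integral_const_mul, hZm,
    hgs 1 (by simp)]
  ring

/-- The optimal decreasing rearrangement. -/
def optimal (g : ℝ → ℝ) (q c m v t : ℝ) : ℝ :=
  m + v * (sPow q (rDeriv g t - c) * ((∫ t, |rDeriv g t - c| ^ q ∂unitMeasure) ^ q⁻¹) ^ (1 - q))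

theorem antitoneOn_optimal (hq : 1 < q) (hv : 0 < v) (hg : ConcaveOn ℝ (Icc 0 1) g) :
    AntitoneOn (optimal g q c m v) (Ioo 0 1) := by
  intro s hs t ht hst
  refine add_le_add_right (mul_le_mul_of_nonneg_left (mul_le_mul_of_nonneg_right
    (monotone_sPow hq (sub_le_sub_right (antitoneOn_rDeriv hg hs ht hst) c)) ?_) hv.le) m
  exact Real.rpow_nonneg (Real.rpow_nonneg (integral_nonneg fun t =>
    Real.rpow_nonneg (abs_nonneg _) _) _) _

/-- The mean is `m` by the first-order condition at `c`. Since `(q - 1) p = q`, the `p`-th moment is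
a multiple of `∫ |g' - c|^q = N^q`, and the riskmetric exceeds `m g(1)` by `v N^(1 - q) N^q = v N`.
-/
theorem optimal_properties (hpq : q.HolderConjugate p) (hv : 0 < v) (hg : ConcaveOn ℝ (Icc 0 1) g)
    (hM : ∀ t ∈ Icc (0 : ℝ) 1, g t ≤ M) (hc : ContinuousOn g (Icc 0 1)) (h0 : g 0 = 0)
    (hmin : ∀ x, devNorm g q c ≤ devNorm g q x) (hfin : devNorm g q c ≠ ⊤) :
    unitMeasure.map (optimal g q c m v) ∈ momentSet p m v ∧
      RiskmetricFinite g (unitMeasure.map (optimal g q c m v)) ∧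
      riskmetric g (unitMeasure.map (optimal g q c m v)) =
        m * g 1 + v * (devNorm g q c).toReal := by
  have hq : 1 < q := hpq.lt
  have hk := memLp_rDeriv hg hM hfin
  have hf : MemLp (fun t => rDeriv g t - c) (ENNReal.ofReal q) unitMeasure := hk.sub (memLp_const c)
  have hmin' : ∀ x, eLpNorm (fun t => rDeriv g t - c) (ENNReal.ofReal q) unitMeasure ≤
      eLpNorm (fun t => rDeriv g t - x) (ENNReal.ofReal q) unitMeasure := fun x => by
    rw [← devNorm_eq_rDeriv hg hM, ← devNorm_eq_rDeriv hg hM]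
    exact hmin x
  have hmean := integral_sPow_eq_zero hq hk hmin'
  have hfi := integrable_abs_rpow hq hf
  have hZr := isRearrangement_of_antitoneOn (antitoneOn_optimal (c := c) (m := m) hq hv hg)
  rw [toReal_devNorm hq hg hM hfin]
  set I := ∫ t, |rDeriv g t - c| ^ q ∂unitMeasure with hI
  have hI0 : 0 ≤ I := integral_nonneg fun a => Real.rpow_nonneg (abs_nonneg _) _
  set N := I ^ q⁻¹ with hN
  have hN0 : 0 ≤ N := Real.rpow_nonneg hI0 _
  have hNq : N ^ q = I := by
    rw [hN, ← Real.rpow_mul hI0, inv_mul_cancel₀ hpq.ne_zero, Real.rpow_one]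
  have hZ : ∀ t, optimal g q c m v t - m = v * (sPow q (rDeriv g t - c) * N ^ (1 - q)) := by
    intro t
    simp [optimal, ← hI, ← hN]
  have hqp : (q - 1) * p = q := by
    have := hpq.inv_add_inv_eq_one
    have h1 := hpq.ne_zero
    have h2 := hpq.symm.ne_zero
    field_simp at this
    linarith
  have habs : ∀ t, |optimal g q c m v t - m| ^ p =
      v ^ p * (N ^ (1 - q)) ^ p * |rDeriv g t - c| ^ q := fun t => by
    rw [hZ, abs_mul, abs_mul, abs_sPow hq, abs_of_pos hv, abs_of_nonneg (Real.rpow_nonneg hN0 _),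
      Real.mul_rpow hv.le (by positivity), Real.mul_rpow (by positivity) (by positivity),
      ← Real.rpow_mul (abs_nonneg _), hqp]
    ring
  -- Equality holds unless `N = 0`; then the convention `0 ^ (1 - q) = 0` makes the left side `0`
  -- and the optimal function the constant `m`.
  have hNp : (N ^ (1 - q)) ^ p * I ≤ 1 := by
    rcases hN0.eq_or_lt with h | h
    · rw [← h, Real.zero_rpow (by linarith : 1 - q ≠ 0), Real.zero_rpow hpq.symm.ne_zero, zero_mul]
      exact zero_le_one
    · rw [← Real.rpow_mul hN0, show (1 - q) * p = -q by linarith, Real.rpow_neg hN0, hNq,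
        inv_mul_cancel₀]
      rw [← hNq]
      exact (Real.rpow_pos_of_pos h q).ne'
  have hZmem : MemLp (fun t => optimal g q c m v t - m) (ENNReal.ofReal p) unitMeasure := by
    have hsm : AEStronglyMeasurable (fun t => optimal g q c m v t - m) unitMeasure :=
      (hZr.aemeasurable.sub_const m).aestronglyMeasurable
    rw [← integrable_norm_rpow_iff hsm (by simpa using hpq.symm.pos) (by simp),
      ENNReal.toReal_ofReal hpq.symm.nonneg]
    simp only [Real.norm_eq_abs, habs]
    exact hfi.const_mul _
  have hZ0 : ∫ t, (optimal g q c m v t - m) ∂unitMeasure = 0 := by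
    simp only [hZ]
    rw [integral_const_mul, integral_mul_const, hmean]
    simp
  have hmem : unitMeasure.map (optimal g q c m v) ∈ momentSet p m v := by
    refine map_mem_momentSet hpq.symm.lt ?_ ?_ ?_
    · refine (hZmem.add (memLp_const m)).ae_eq (Eventually.of_forall fun t => ?_)
      simp
    · have hi : Integrable (fun t => optimal g q c m v t - m) unitMeasure :=
        hZmem.integrable (by simpa using hpq.symm.lt.le)
      have : (fun t => optimal g q c m v t) = fun t => (optimal g q c m v t - m) + m := by
        ext t
        ring
      rw [this, integral_add hi (integrable_const m), hZ0]
      simp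
    · simp only [habs]
      rw [integral_const_mul, ← hI, mul_assoc]
      exact mul_le_of_le_one_right (by positivity) hNp
  have := hmem.1
  obtain ⟨h1, h2⟩ := riskmetric_eq_of_rearrangement hpq hg hc h0 hk hZr hZmem hZ0 c
  refine ⟨hmem, h1, h2.trans ?_⟩
  congr 1
  have : (fun t => (rDeriv g t - c) * (optimal g q c m v t - m)) =
      fun t => v * N ^ (1 - q) * |rDeriv g t - c| ^ q := by
    ext t
    rw [hZ, ← sPow_mul_self hq]
    ring
  rw [this, integral_const_mul, ← hI, mul_assoc]
  congr 1
  rcases hN0.eq_or_lt with h | h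
  · rw [← h, Real.zero_rpow (by linarith : 1 - q ≠ 0), zero_mul]
  · rw [← hNq, ← Real.rpow_add h]
    simp

theorem rDeriv_of_eqOn_chord {a b : ℝ} (hab : ∀ t ∈ Icc a b, g t = chord g a b t) {t : ℝ}
    (ht : t ∈ Ioo a b) : rDeriv g t = (g b - g a) / (b - a) := by
  have hd : HasDerivAt (chord g a b) ((g b - g a) / (b - a)) t := by
    have := (((hasDerivAt_id t).sub_const a).const_mul ((g b - g a) / (b - a))).const_add (g a)
    change HasDerivAt (fun x => g a + (g b - g a) / (b - a) * (x - a)) _ t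
    simpa using this
  have he : g =ᶠ[𝓝 t] chord g a b := by
    filter_upwards [Ioo_mem_nhds ht.1 ht.2] with u hu
    exact hab u (Ioo_subset_Icc_self hu)
  exact (hd.congr_of_eventuallyEq he).hasDerivWithinAt.derivWithin (uniqueDiffWithinAt_Ioi t)

end concave

/-! ### Upper bound through the envelope, and coincidence at the extremal law -/

section envelope

variable {h : ℝ → ℝ} {M p q c m v : ℝ}

/-- Upper bound for the riskmetric over a moment set, with the form of the maximizers. -/
theorem riskmetric_le (hpq : q.HolderConjugate p) (hv : 0 < v) (h0 : h 0 = 0)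
    (hM : ∀ t ∈ Icc (0 : ℝ) 1, h t ≤ M) (hc : ContinuousOn (concaveEnvelope h) (Icc 0 1))
    (hfin : devNorm (concaveEnvelope h) q c ≠ ⊤) {F : Measure ℝ} (hF : F ∈ admissible h p m v) :
    riskmetric h F ≤ m * h 1 + v * (devNorm (concaveEnvelope h) q c).toReal ∧
      (0 < (devNorm (concaveEnvelope h) q c).toReal →
        m * h 1 + v * (devNorm (concaveEnvelope h) q c).toReal ≤ riskmetric h F →
        ∀ᵐ t ∂unitMeasure, quantile F (1 - t) = optimal (concaveEnvelope h) q c m v t) := by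
  obtain ⟨hFm, hFf⟩ := hF
  have := hFm.1
  have hg := concaveOn_concaveEnvelope h0 hM
  have hgM : ∀ t ∈ Icc (0 : ℝ) 1, concaveEnvelope h t ≤ M := fun t ht =>
    concaveEnvelope_le_bound h0 hM ht
  have hg0 := concaveEnvelope_zero h0 hM
  have hg1 := concaveEnvelope_one h0 hM
  have hle : ∀ t ∈ Icc (0 : ℝ) 1, h t ≤ concaveEnvelope h t := fun t ht =>
    le_concaveEnvelope h0 hM ht
  set g := concaveEnvelope h
  have hk := memLp_rDeriv hg hgM hfin
  have hZ := isRearrangement_quantile (F := F)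
  obtain ⟨hZp, hZ0, hZv⟩ := moments_of_mem hpq.symm.lt hv hFm hZ.aemeasurable hZ.map_eq
  obtain ⟨hgf, hgr⟩ := riskmetric_eq_of_rearrangement hpq hg hc hg0 hk hZ hZp hZ0 c
  have hmono : riskmetric h F ≤ riskmetric g F := by
    refine add_le_add (integral_mono hFf.1 hgf.1 fun x => hle _ (real_mem_Icc _))
      (integral_mono hFf.2 hgf.2 fun x => ?_)
    simp only [hg1]
    exact sub_le_sub_right (hle _ (real_mem_Icc _)) _
  obtain ⟨H1, H2⟩ := holder_of_le (f := fun t => rDeriv g t - c) hpq hv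
    (hk.sub (memLp_const c)) hZp hZv
  rw [hg1] at hgr
  rw [toReal_devNorm hpq.lt hg hgM hfin]
  refine ⟨by linarith, fun hN hge => ?_⟩
  filter_upwards [H2 hN (by linarith)] with t ht
  rw [optimal, ← ht]
  ring

/-- If `h` is upper semicontinuous on `(0,1)`, the law of the optimal rearrangement for the concave
envelope does not see the points where `h` differs from its envelope. -/
theorem eq_concaveEnvelope_of_optimal (hq : 1 < q) (hv : 0 < v) (h0 : h 0 = 0)
    (hM : ∀ t ∈ Icc (0 : ℝ) 1, h t ≤ M) (hc : ContinuousOn (concaveEnvelope h) (Icc 0 1))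
    (husc : ∀ s ∈ Ioo (0 : ℝ) 1, ∀ y, h s < y → ∀ᶠ t in 𝓝 s, h t < y) (x : ℝ) :
    h ((unitMeasure.map (optimal (concaveEnvelope h) q c m v)).real (Ioi x)) =
      concaveEnvelope h
        ((unitMeasure.map (optimal (concaveEnvelope h) q c m v)).real (Ioi x)) := by
  have hanti := antitoneOn_optimal (c := c) (m := m) hq hv (concaveOn_concaveEnvelope h0 hM)
  have hm : AEMeasurable (optimal (concaveEnvelope h) q c m v) unitMeasure :=
    aemeasurable_restrict_of_antitoneOn measurableSet_Ioo hanti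
  have := Measure.isProbabilityMeasure_map hm
  have hconst := fun a b C ha hb hC =>
    real_Ioi_notMem_of_const hanti (a := a) (b := b) (C := C) ha hb hC x
  have hs := real_mem_Icc (F := unitMeasure.map (optimal (concaveEnvelope h) q c m v)) (Ioi x)
  set s := (unitMeasure.map (optimal (concaveEnvelope h) q c m v)).real (Ioi x)
  -- If `h` and its envelope differed at `s`, the envelope would be affine around `s` and the
  -- optimal function constant there, so `s` could not be a tail probability.
  by_contra hne
  have hlt : h s < concaveEnvelope h s := lt_of_le_of_ne (le_concaveEnvelope h0 hM hs) hne
  have hs0 : s ≠ 0 := by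
    intro e
    rw [e, concaveEnvelope_zero h0 hM, h0] at hne
    exact hne rfl
  have hs1 : s ≠ 1 := by
    intro e
    rw [e, concaveEnvelope_one h0 hM] at hne
    exact hne rfl
  have hs' : s ∈ Ioo (0 : ℝ) 1 := ⟨lt_of_le_of_ne hs.1 hs0.symm, lt_of_le_of_ne hs.2 hs1⟩
  obtain ⟨a, b, ha, has, hsb, hb, hab⟩ := exists_affine_of_lt h0 hM hc hs' (husc s hs') hlt
  refine hconst a b (optimal (concaveEnvelope h) q c m v s) ha hb (fun t ht => ?_) ⟨has, hsb⟩
  rw [optimal, optimal, rDeriv_of_eqOn_chord hab ht, rDeriv_of_eqOn_chord hab ⟨has, hsb⟩]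

end envelope

/-! ### Restriction of the distortion function to a finite grid -/

section grid

variable {h : ℝ → ℝ} {M p q m v : ℝ} {G : Finset ℝ}

open Classical in
/-- The function `h` on the finite set `G`, lowered to `-(M + 1)` elsewhere. -/
def gridFun (h : ℝ → ℝ) (M : ℝ) (G : Finset ℝ) (t : ℝ) : ℝ := if t ∈ G then h t else -(M + 1)

/-- A finite set of points of `[0,1]` containing the end points. -/
structure IsGrid (G : Finset ℝ) : Prop where
  zero_mem : 0 ∈ G
  one_mem : 1 ∈ G
  subset : ∀ t ∈ G, t ∈ Icc (0 : ℝ) 1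

theorem gridFun_of_mem {t : ℝ} (ht : t ∈ G) : gridFun h M G t = h t := if_pos ht

theorem gridFun_of_notMem {t : ℝ} (ht : t ∉ G) : gridFun h M G t = -(M + 1) := if_neg ht

theorem gridFun_le (hM : ∀ t ∈ Icc (0 : ℝ) 1, |h t| ≤ M) {t : ℝ} (ht : t ∈ Icc (0 : ℝ) 1) :
    gridFun h M G t ≤ h t := by
  have := (abs_le.1 (hM t ht)).1
  unfold gridFun
  split_ifs <;> linarith

theorem gridFun_mono (hM : ∀ t ∈ Icc (0 : ℝ) 1, |h t| ≤ M) {G' : Finset ℝ} (hGG : G ⊆ G') {t : ℝ}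
    (ht : t ∈ Icc (0 : ℝ) 1) : gridFun h M G t ≤ gridFun h M G' t := by
  by_cases hG : t ∈ G
  · rw [gridFun_of_mem hG, gridFun_of_mem (hGG hG)]
  · rw [gridFun_of_notMem hG]
    have := (abs_le.1 (hM t ht)).1
    unfold gridFun
    split_ifs <;> linarith

theorem gridFun_le_bound (hM : ∀ t ∈ Icc (0 : ℝ) 1, |h t| ≤ M) {t : ℝ} (ht : t ∈ Icc (0 : ℝ) 1) :
    gridFun h M G t ≤ M :=
  (gridFun_le hM ht).trans (abs_le.1 (hM t ht)).2

/-- Near `s` there is no other grid point, and off the grid the function takes its minimal value. -/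
theorem gridFun_usc (hM : ∀ t ∈ Icc (0 : ℝ) 1, |h t| ≤ M) {s : ℝ} (hs : s ∈ Icc (0 : ℝ) 1) {y : ℝ}
    (hy : gridFun h M G s < y) : ∀ᶠ t in 𝓝 s, gridFun h M G t < y := by
  have hlow : -(M + 1) ≤ gridFun h M G s := by
    have := (abs_le.1 (hM s hs)).1
    unfold gridFun
    split_ifs <;> linarith
  have hev : ∀ᶠ t in 𝓝 s, t ∉ (G.erase s : Set ℝ) :=
    (G.erase s).finite_toSet.isClosed.isOpen_compl.mem_nhds (by simp)
  filter_upwards [hev] with t ht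
  by_cases hts : t = s
  · rwa [hts]
  · have : t ∉ G := fun hG => ht (by simp [hts, hG])
    rw [gridFun_of_notMem this]
    exact hlow.trans_lt hy

theorem exists_slope_bound (h0 : h 0 = 0) (hM : ∀ t ∈ Icc (0 : ℝ) 1, |h t| ≤ M) :
    ∃ L, M ≤ L ∧ ∀ t ∈ Icc (0 : ℝ) 1, gridFun h M G t ≤ L * t ∧
      gridFun h M G t ≤ h 1 + L * (1 - t) := by
  have hM0 : 0 ≤ M := (abs_nonneg _).trans (hM 0 (by simp))
  have hh1 := abs_le.1 (hM 1 (by simp))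
  set A := ∑ t ∈ G, |h t / t| with hA
  set B := ∑ t ∈ G, |(h t - h 1) / (1 - t)| with hB
  have hA0 : 0 ≤ A := Finset.sum_nonneg fun _ _ => abs_nonneg _
  have hB0 : 0 ≤ B := Finset.sum_nonneg fun _ _ => abs_nonneg _
  -- `A` and `B` dominate the slopes from all grid points to `(0, 0)` and `(1, h 1)`, with division
  -- by zero contributing `0`. Adding `M` gives `M ≤ L`, so both lines also dominate the negative
  -- value taken off the grid.
  refine ⟨A + B + M, by linarith, fun t ht => ?_⟩
  have hL0 : 0 ≤ A + B + M := by linarith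
  by_cases htG : t ∈ G
  · rw [gridFun_of_mem htG]
    have h1 : |h t / t| ≤ A := Finset.single_le_sum (f := fun t => |h t / t|)
      (fun _ _ => abs_nonneg _) htG
    have h2 : |(h t - h 1) / (1 - t)| ≤ B :=
      Finset.single_le_sum (f := fun t => |(h t - h 1) / (1 - t)|) (fun _ _ => abs_nonneg _) htG
    constructor
    · rcases ht.1.eq_or_lt with h | h
      · rw [← h, h0, mul_zero]
      · rw [← div_le_iff₀ h]
        linarith [(le_abs_self _).trans h1]
    · rcases ht.2.eq_or_lt with h | h
      · rw [h]
        linarith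
      · have h3 := (le_abs_self _).trans h2
        rw [div_le_iff₀ (by linarith)] at h3
        nlinarith [ht.2]
  · rw [gridFun_of_notMem htG]
    have e1 := mul_nonneg hL0 ht.1
    have e2 := mul_nonneg hL0 (sub_nonneg.2 ht.2)
    constructor <;> linarith

theorem concaveOn_affine (a b : ℝ) : ConcaveOn ℝ (Icc (0 : ℝ) 1) fun t => a + b * t := by
  refine ⟨convex_Icc 0 1, ?_⟩
  intro x _ y _ u w _ _ huw
  simp only [smul_eq_mul]
  have : w = 1 - u := by linarith
  subst this
  exact le_of_eq (by ring)

/-- The envelope lies above the chord joining its end points and below the minimum of two lines of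
slopes `L` and `-L`. This yields continuity at `0` and `1` and bounded slopes. -/
theorem envelope_grid_bounds (h0 : h 0 = 0) (hM : ∀ t ∈ Icc (0 : ℝ) 1, |h t| ≤ M) (hG : IsGrid G) :
    ∃ L, ∀ t ∈ Icc (0 : ℝ) 1, h 1 * t ≤ concaveEnvelope (gridFun h M G) t ∧
      concaveEnvelope (gridFun h M G) t ≤ L * t ∧
      concaveEnvelope (gridFun h M G) t ≤ h 1 + L * (1 - t) := by
  obtain ⟨L, hML, hL⟩ := exists_slope_bound (G := G) h0 hM
  have hM0 : 0 ≤ M := (abs_nonneg _).trans (hM 0 (by simp))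
  have hh1 := abs_le.1 (hM 1 (by simp))
  have hg0 : gridFun h M G 0 = 0 := (gridFun_of_mem hG.zero_mem).trans h0
  have hgM : ∀ t ∈ Icc (0 : ℝ) 1, gridFun h M G t ≤ M := fun t ht => gridFun_le_bound hM ht
  refine ⟨L, fun t ht => ⟨?_, ?_⟩⟩
  · have h1 := (concaveOn_concaveEnvelope hg0 hgM).2 (x := 0) (by simp) (y := 1) (by simp)
      (sub_nonneg.2 ht.2) ht.1 (by ring)
    rw [concaveEnvelope_zero hg0 hgM, concaveEnvelope_one hg0 hgM, gridFun_of_mem hG.one_mem] at h1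
    simp only [smul_eq_mul, mul_zero, zero_add, mul_one] at h1
    linarith
  · have hcomp : concaveEnvelope (gridFun h M G) t ≤
        ((fun t => 0 + L * t) ⊓ fun t => (h 1 + L) + (-L) * t) t := by
      refine concaveEnvelope_le (M := L) ((concaveOn_affine _ _).inf (concaveOn_affine _ _))
        ?_ ?_ ?_ ht
      · change min (0 + L * 0) (h 1 + L + -L * 0) = 0
        rw [min_eq_left] <;> linarith
      · intro s hs
        refine inf_le_left.trans ?_
        have := mul_le_mul_of_nonneg_left hs.2 (hM0.trans hML)
        simp only
        linarith
      · intro s hs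
        obtain ⟨e1, e2⟩ := hL s hs
        refine le_inf ?_ ?_
        · simp only
          linarith
        · simp only
          linarith
    have e1 := hcomp.trans inf_le_left
    have e2 := hcomp.trans inf_le_right
    simp only at e1 e2
    exact ⟨by linarith, by linarith⟩

theorem continuousOn_of_concave_of_bounds {g : ℝ → ℝ} (hg : ConcaveOn ℝ (Icc 0 1) g)
    (hz : ContinuousWithinAt g (Icc 0 1) 0) (ho : ContinuousWithinAt g (Icc 0 1) 1) :
    ContinuousOn g (Icc 0 1) := by
  intro t ht
  rcases ht.1.eq_or_lt with h | h
  · rwa [← h]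
  rcases ht.2.eq_or_lt with h' | h'
  · rwa [h']
  have := hg.continuousOn_interior
  rw [interior_Icc] at this
  exact (this.continuousAt (Ioo_mem_nhds h h')).continuousWithinAt

theorem continuousOn_envelope_grid (h0 : h 0 = 0) (hM : ∀ t ∈ Icc (0 : ℝ) 1, |h t| ≤ M)
    (hG : IsGrid G) : ContinuousOn (concaveEnvelope (gridFun h M G)) (Icc 0 1) := by
  obtain ⟨L, hL⟩ := envelope_grid_bounds h0 hM hG
  have hg0 : gridFun h M G 0 = 0 := (gridFun_of_mem hG.zero_mem).trans h0
  have hgM : ∀ t ∈ Icc (0 : ℝ) 1, gridFun h M G t ≤ M := fun t ht => gridFun_le_bound hM ht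
  refine continuousOn_of_concave_of_bounds (concaveOn_concaveEnvelope hg0 hgM) ?_ ?_
  · have e1 : ContinuousWithinAt (fun t : ℝ => h 1 * t) (Icc 0 1) 0 := by fun_prop
    have e2 : ContinuousWithinAt (fun t : ℝ => L * t) (Icc 0 1) 0 := by fun_prop
    unfold ContinuousWithinAt at e1 e2 ⊢
    rw [concaveEnvelope_zero hg0 hgM]
    simp only [mul_zero] at e1 e2
    exact tendsto_of_tendsto_of_tendsto_of_le_of_le' e1 e2
      (eventually_mem_nhdsWithin.mono fun t ht => (hL t ht).1)
      (eventually_mem_nhdsWithin.mono fun t ht => (hL t ht).2.1)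
  · have e1 : ContinuousWithinAt (fun t : ℝ => h 1 * t) (Icc 0 1) 1 := by fun_prop
    have e2 : ContinuousWithinAt (fun t : ℝ => h 1 + L * (1 - t)) (Icc 0 1) 1 := by fun_prop
    unfold ContinuousWithinAt at e1 e2 ⊢
    rw [concaveEnvelope_one hg0 hgM, gridFun_of_mem hG.one_mem]
    simp only [mul_one] at e1
    simp only [sub_self, mul_zero, add_zero] at e2
    exact tendsto_of_tendsto_of_tendsto_of_le_of_le' e1 e2
      (eventually_mem_nhdsWithin.mono fun t ht => (hL t ht).1)
      (eventually_mem_nhdsWithin.mono fun t ht => (hL t ht).2.2)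

theorem devNorm_envelope_grid_ne_top (h0 : h 0 = 0) (hM : ∀ t ∈ Icc (0 : ℝ) 1, |h t| ≤ M)
    (hG : IsGrid G) (x : ℝ) : devNorm (concaveEnvelope (gridFun h M G)) q x ≠ ⊤ := by
  obtain ⟨L, hL⟩ := envelope_grid_bounds h0 hM hG
  have hg0 : gridFun h M G 0 = 0 := (gridFun_of_mem hG.zero_mem).trans h0
  have hgM : ∀ t ∈ Icc (0 : ℝ) 1, gridFun h M G t ≤ M := fun t ht => gridFun_le_bound hM ht
  have hc := concaveOn_concaveEnvelope hg0 hgM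
  -- By concavity the right derivative lies between the slopes to the two end points.
  have hb : ∀ t ∈ Ioo (0 : ℝ) 1, |rDeriv (concaveEnvelope (gridFun h M G)) t| ≤ L := by
    intro t ht
    obtain ⟨e1, e2, e3⟩ := hL t (Ioo_subset_Icc_self ht)
    have h1 := slope_le_rDeriv hc ht (u := 1) (by simp) ht.2
    have h2 := rDeriv_le_slope hc ht (u := 0) (by simp) ht.1
    rw [concaveEnvelope_one hg0 hgM, gridFun_of_mem hG.one_mem] at h1
    rw [concaveEnvelope_zero hg0 hgM, sub_zero, sub_zero] at h2
    rw [abs_le]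
    constructor
    · refine le_trans ?_ h1
      rw [le_div_iff₀ (by linarith [ht.2])]
      linarith
    · refine h2.trans ?_
      rwa [div_le_iff₀ ht.1]
  rw [devNorm_eq_rDeriv hc (fun t ht => concaveEnvelope_le_bound hg0 hgM ht)]
  have hm : AEStronglyMeasurable (rDeriv (concaveEnvelope (gridFun h M G))) unitMeasure :=
    (aemeasurable_restrict_of_antitoneOn measurableSet_Ioo
      (antitoneOn_rDeriv hc)).aestronglyMeasurable
  have : MemLp (rDeriv (concaveEnvelope (gridFun h M G))) (ENNReal.ofReal q) unitMeasure :=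
    MemLp.of_bound hm L ((ae_restrict_mem measurableSet_Ioo).mono fun t ht => hb t ht)
  exact (this.sub (memLp_const x)).2.ne

/-- Every grid yields an admissible law whose riskmetric is the bound of the gridded function. -/
theorem exists_admissible_of_grid (hpq : q.HolderConjugate p) (hv : 0 < v) (h0 : h 0 = 0)
    (hM : ∀ t ∈ Icc (0 : ℝ) 1, |h t| ≤ M) (hG : IsGrid G) {c : ℝ}
    (hmin : ∀ x, devNorm (concaveEnvelope (gridFun h M G)) q c ≤
      devNorm (concaveEnvelope (gridFun h M G)) q x) :
    ∃ F ∈ admissible h p m v, riskmetric h F =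
      m * h 1 + v * (devNorm (concaveEnvelope (gridFun h M G)) q c).toReal := by
  have hg0 : gridFun h M G 0 = 0 := (gridFun_of_mem hG.zero_mem).trans h0
  have hgM : ∀ t ∈ Icc (0 : ℝ) 1, gridFun h M G t ≤ M := fun t ht => gridFun_le_bound hM ht
  have hc := continuousOn_envelope_grid h0 hM hG
  have hconc := concaveOn_concaveEnvelope hg0 hgM
  have hbd := envelope_grid_bounds h0 hM hG
  have hg1 : concaveEnvelope (gridFun h M G) 1 = h 1 := by
    rw [concaveEnvelope_one hg0 hgM, gridFun_of_mem hG.one_mem]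
  obtain ⟨hF, hFf, hFr⟩ := optimal_properties (m := m) (v := v) hpq hv hconc
    (fun t ht => concaveEnvelope_le_bound hg0 hgM ht) hc (concaveEnvelope_zero hg0 hgM) hmin
    (devNorm_envelope_grid_ne_top h0 hM hG c)
  have hcoin := eq_concaveEnvelope_of_optimal (m := m) (c := c) hpq.lt hv hg0 hgM hc
    (fun s hs y hy => gridFun_usc hM (Ioo_subset_Icc_self hs) hy)
  have := hF.1
  set F := unitMeasure.map (optimal (concaveEnvelope (gridFun h M G)) q c m v)
  have heq : ∀ x, h (F.real (Ioi x)) = concaveEnvelope (gridFun h M G) (F.real (Ioi x)) := by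
    intro x
    rw [← hcoin x]
    have hs := real_mem_Icc (F := F) (Ioi x)
    have hsG : F.real (Ioi x) ∈ G := by
      -- The envelope is at least `h 1 * t ≥ -M`, hence above the off-grid value `-(M + 1)`; so
      -- coincidence with the envelope puts every tail probability on the grid.
      by_contra hcon
      have h1 := hcoin x
      rw [gridFun_of_notMem hcon] at h1
      obtain ⟨L, hL⟩ := hbd
      have h2 := (hL _ hs).1
      have hh1 := (abs_le.1 (hM 1 (by simp))).1
      have hM0 : 0 ≤ M := (abs_nonneg _).trans (hM 0 (by simp))
      nlinarith [hs.1, hs.2]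
    rw [gridFun_of_mem hsG]
  refine ⟨F, ⟨hF, ?_⟩, ?_⟩
  · unfold RiskmetricFinite at hFf ⊢
    simpa only [heq, hg1] using hFf
  · rw [← hg1, ← hFr]
    unfold riskmetric
    simp only [heq, hg1]

end grid

/-! ### Lower semicontinuity of the central norm and approximation by grids -/

section approx

/-- Each right derivative lies between a forward and a backward difference quotient; these converge
in `n`, and their limits are close to `deriv g t` for small steps. -/
theorem tendsto_rDeriv {gs : ℕ → ℝ → ℝ} {g : ℝ → ℝ} (hgs : ∀ n, ConcaveOn ℝ (Icc 0 1) (gs n))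
    (hlim : ∀ t ∈ Icc (0 : ℝ) 1, Tendsto (fun n => gs n t) atTop (𝓝 (g t))) {t : ℝ}
    (ht : t ∈ Ioo (0 : ℝ) 1) (hd : DifferentiableAt ℝ g t) :
    Tendsto (fun n => rDeriv (gs n) t) atTop (𝓝 (deriv g t)) := by
  have hsl := (hasDerivAt_iff_tendsto_slope.1 hd.hasDerivAt)
  have ht' := Ioo_subset_Icc_self ht
  refine tendsto_order.2 ⟨fun a ha => ?_, fun a ha => ?_⟩
  · have h1 : ∀ᶠ u in 𝓝[>] t, a < slope g t u :=
      (hsl.mono_left (nhdsWithin_mono t fun u (hu : t < u) => hu.ne')).eventually (lt_mem_nhds ha)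
    obtain ⟨u, hu1, hu2⟩ := (h1.and (Ioo_mem_nhdsGT ht.2)).exists
    have hu : u ∈ Icc (0 : ℝ) 1 := ⟨ht.1.le.trans hu2.1.le, hu2.2.le⟩
    rw [slope_def_field] at hu1
    have h2 : Tendsto (fun n => (gs n u - gs n t) / (u - t)) atTop (𝓝 ((g u - g t) / (u - t))) :=
      ((hlim u hu).sub (hlim t ht')).div_const _
    filter_upwards [h2.eventually (lt_mem_nhds hu1)] with n hn
    exact hn.trans_le (slope_le_rDeriv (hgs n) ht hu hu2.1)
  · have h1 : ∀ᶠ u in 𝓝[<] t, slope g t u < a :=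
      (hsl.mono_left (nhdsWithin_mono t fun u (hu : u < t) => hu.ne)).eventually (gt_mem_nhds ha)
    obtain ⟨u, hu1, hu2⟩ := (h1.and (Ioo_mem_nhdsLT ht.1)).exists
    have hu : u ∈ Icc (0 : ℝ) 1 := ⟨hu2.1.le, hu2.2.le.trans ht.2.le⟩
    rw [slope_comm, slope_def_field] at hu1
    have h2 : Tendsto (fun n => (gs n t - gs n u) / (t - u)) atTop (𝓝 ((g t - g u) / (t - u))) :=
      ((hlim t ht').sub (hlim u hu)).div_const _
    filter_upwards [h2.eventually (gt_mem_nhds hu1)] with n hn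
    exact (rDeriv_le_slope (hgs n) ht hu hu2.2).trans_lt hn

/-- Hölder's inequality for the integral of `g' - c` over `(a, b)`. The modulus depends only on `B`
and `q`, so it survives pointwise limits. -/
theorem holder_of_devNorm_le {g : ℝ → ℝ} {M q c B : ℝ} (hq : 1 < q) (hg : ConcaveOn ℝ (Icc 0 1) g)
    (hM : ∀ t ∈ Icc (0 : ℝ) 1, g t ≤ M) (hc : ContinuousOn g (Icc 0 1)) (hB : 0 ≤ B)
    (hdev : devNorm g q c ≤ ENNReal.ofReal B) {a b : ℝ} (ha : 0 ≤ a) (hab : a ≤ b) (hb : b ≤ 1) :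
    |g b - g a - c * (b - a)| ≤ B * (b - a) ^ (1 - 1 / q) := by
  have hfin : devNorm g q c ≠ ⊤ := ne_top_of_le_ne_top ENNReal.ofReal_ne_top hdev
  have hk := memLp_rDeriv hg hM hfin
  have hki : Integrable (rDeriv g) unitMeasure := hk.integrable (by simpa using hq.le)
  have hsub : Ioo a b ⊆ Ioo 0 1 := Ioo_subset_Ioo ha hb
  have hint : ∫ t in Ioo a b, (rDeriv g t - c) = g b - g a - c * (b - a) := by
    rw [integral_sub (IntegrableOn.mono_set hki hsub) (integrable_const c),
      setIntegral_Ioo_rDeriv hg hc hki ha hab hb]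
    simp [hab, mul_comm]
  have hr : (volume.restrict (Ioo a b)) ≤ unitMeasure := Measure.restrict_mono hsub le_rfl
  have h1 := enorm_integral_le_lintegral_enorm (μ := volume.restrict (Ioo a b))
    fun t => rDeriv g t - c
  have hm : AEStronglyMeasurable (fun t => rDeriv g t - c) (volume.restrict (Ioo a b)) :=
    (hk.1.sub aestronglyMeasurable_const).mono_measure hr
  have h2 := eLpNorm_le_eLpNorm_mul_rpow_measure_univ (p := 1) (q := ENNReal.ofReal q)
    (by simpa using hq.le) hm
  rw [eLpNorm_one_eq_lintegral_enorm, Measure.restrict_apply_univ, Real.volume_Ioo,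
    ENNReal.toReal_one, ENNReal.toReal_ofReal (by linarith), div_one] at h2
  have h3 : eLpNorm (fun t => rDeriv g t - c) (ENNReal.ofReal q) (volume.restrict (Ioo a b)) ≤
      ENNReal.ofReal B := by
    refine (eLpNorm_mono_measure _ hr).trans ?_
    rwa [← devNorm_eq_rDeriv hg hM]
  have hexp : 0 ≤ 1 - 1 / q := by
    rw [sub_nonneg, div_le_one (by linarith)]
    exact hq.le
  have h4 := h1.trans (h2.trans (mul_le_mul_left h3 _))
  rw [hint, ENNReal.ofReal_rpow_of_nonneg (sub_nonneg.2 hab) hexp, ← ENNReal.ofReal_mul hB,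
    Real.enorm_eq_ofReal_abs, ENNReal.ofReal_le_ofReal_iff] at h4
  · exact h4
  · exact mul_nonneg hB (Real.rpow_nonneg (sub_nonneg.2 hab) _)

theorem continuousOn_of_holder {g : ℝ → ℝ} {c B r : ℝ} (hr : 0 < r)
    (h : ∀ a b, 0 ≤ a → a ≤ b → b ≤ 1 → |g b - g a - c * (b - a)| ≤ B * (b - a) ^ r) :
    ContinuousOn g (Icc 0 1) := by
  intro x hx
  have hbound : ∀ y ∈ Icc (0 : ℝ) 1, |g y - g x - c * (y - x)| ≤ B * |y - x| ^ r := by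
    intro y hy
    rcases le_total x y with hxy | hxy
    · rw [abs_of_nonneg (sub_nonneg.2 hxy)]
      exact h x y hx.1 hxy hy.2
    · rw [abs_sub_comm y x, abs_of_nonneg (sub_nonneg.2 hxy), ← abs_neg]
      refine le_trans (le_of_eq ?_) (h y x hy.1 hxy hx.2)
      congr 1
      ring
  have h1 : Tendsto (fun y => B * |y - x| ^ r) (𝓝[Icc 0 1] x) (𝓝 0) := by
    have : Continuous fun y : ℝ => B * |y - x| ^ r :=
      continuous_const.mul ((by fun_prop : Continuous fun y : ℝ => |y - x|).rpow_const
        fun _ => Or.inr hr.le)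
    have h2 := this.tendsto x
    simp only [sub_self, abs_zero, Real.zero_rpow hr.ne', mul_zero] at h2
    exact h2.mono_left nhdsWithin_le_nhds
  have h2 : Tendsto (fun y => g y - g x - c * (y - x)) (𝓝[Icc 0 1] x) (𝓝 0) :=
    squeeze_zero_norm' (eventually_mem_nhdsWithin.mono fun y hy => hbound y hy) h1
  have h3 : Tendsto (fun y : ℝ => g x + c * (y - x)) (𝓝[Icc 0 1] x) (𝓝 (g x)) := by
    have : Continuous fun y : ℝ => g x + c * (y - x) := by fun_prop
    have h4 := this.tendsto x
    simp only [sub_self, mul_zero, add_zero] at h4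
    exact h4.mono_left nhdsWithin_le_nhds
  have h5 := h2.add h3
  rw [zero_add] at h5
  refine h5.congr fun y => ?_
  ring

/-- Lower semicontinuity of the central norm along pointwise limits of concave functions. -/
theorem centralNorm_le_of_tendsto {gs : ℕ → ℝ → ℝ} {g : ℝ → ℝ} {M q B : ℝ} {c : ℕ → ℝ} (hq : 1 < q)
    (hB : 0 ≤ B) (hgs : ∀ n, ConcaveOn ℝ (Icc 0 1) (gs n))
    (hgsM : ∀ n, ∀ t ∈ Icc (0 : ℝ) 1, gs n t ≤ M) (hgsc : ∀ n, ContinuousOn (gs n) (Icc 0 1))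
    (hg : ConcaveOn ℝ (Icc 0 1) g) (hgM : ∀ t ∈ Icc (0 : ℝ) 1, g t ≤ M)
    (hlim : ∀ t ∈ Icc (0 : ℝ) 1, Tendsto (fun n => gs n t) atTop (𝓝 (g t)))
    (hdev : ∀ n, devNorm (gs n) q (c n) ≤ ENNReal.ofReal B) :
    centralNorm g q ≤ ENNReal.ofReal B := by
  have hH := fun n => fun a b => holder_of_devNorm_le hq (hgs n) (hgsM n) (hgsc n) hB (hdev n)
    (a := a) (b := b)
  -- On the whole interval the Hölder estimate reads `|gs n 1 - gs n 0 - c n| ≤ B`, so the centers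
  -- are bounded and a subsequence converges.
  have hbdd : Bornology.IsBounded (range c) := by
    have h1 : Tendsto (fun n => gs n 1 - gs n 0) atTop (𝓝 (g 1 - g 0)) :=
      (hlim 1 (by simp)).sub (hlim 0 (by simp))
    obtain ⟨K, hK⟩ := (Metric.isBounded_range_of_tendsto _ h1).exists_norm_le
    refine isBounded_iff_forall_norm_le.2 ⟨K + B, ?_⟩
    rintro _ ⟨n, rfl⟩
    have h2 := hH n 0 1 le_rfl zero_le_one le_rfl
    rw [sub_zero, mul_one, Real.one_rpow, mul_one] at h2
    have h3 := hK _ ⟨n, rfl⟩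
    rw [Real.norm_eq_abs] at h3 ⊢
    have e : c n = (gs n 1 - gs n 0) - (gs n 1 - gs n 0 - c n) := by ring
    rw [e]
    exact (abs_sub _ _).trans (add_le_add h3 h2)
  obtain ⟨c₀, -, φ, hφ, hcφ⟩ := tendsto_subseq_of_bounded hbdd fun n => mem_range_self n
  have hlimφ : ∀ t ∈ Icc (0 : ℝ) 1, Tendsto (fun n => gs (φ n) t) atTop (𝓝 (g t)) := fun t ht =>
    (hlim t ht).comp hφ.tendsto_atTop
  -- The uniform Hölder estimate passes to the limit and excludes jumps at the end points, where
  -- concavity alone does not.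
  have hcont : ContinuousOn g (Icc 0 1) := by
    refine continuousOn_of_holder (c := c₀) (B := B) (r := 1 - 1 / q) ?_ fun a b ha hab hb => ?_
    · rw [sub_pos, div_lt_one (by linarith)]
      exact hq
    · refine le_of_tendsto (((hlimφ b ⟨ha.trans hab, hb⟩).sub
        (hlimφ a ⟨ha, hab.trans hb⟩)).sub (hcφ.mul_const (b - a))).abs ?_
      exact Eventually.of_forall fun n => hH (φ n) a b ha hab hb
  rw [centralNorm, if_pos hcont]
  refine (iInf_le _ c₀).trans ?_
  have hmeas : ∀ n, AEStronglyMeasurable (fun t => rDeriv (gs (φ n)) t - c (φ n)) unitMeasure :=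
    fun n => ((aemeasurable_restrict_of_antitoneOn measurableSet_Ioo
      (antitoneOn_rDeriv (hgs _))).sub_const _).aestronglyMeasurable
  -- Fatou's lemma, since the derivatives converge a.e.
  have hF := Lp.eLpNorm_lim_le_liminf_eLpNorm (p := ENNReal.ofReal q) hmeas
    (fun t => deriv g t - c₀) (by
      filter_upwards [ae_differentiableAt hg hgM, ae_restrict_mem measurableSet_Ioo] with t ht1 ht2
      exact (tendsto_rDeriv (fun n => hgs (φ n)) hlimφ ht2 ht1).sub hcφ)
  refine hF.trans (liminf_le_of_le (by isBoundedDefault) fun b hb => ?_)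
  obtain ⟨n, hn⟩ := hb.exists
  refine hn.trans ?_
  rw [← devNorm_eq_rDeriv (hgs _) (hgsM _)]
  exact hdev _

variable {h : ℝ → ℝ} {M : ℝ}

/-- Separability of the graph, not only of `[0,1]`: the values of `h` must be approximated too,
including isolated ones at jumps. -/
theorem exists_graph_dense_seq (h : ℝ → ℝ) : ∃ d : ℕ → ℝ, (∀ n, d n ∈ Icc (0 : ℝ) 1) ∧
    ∀ t ∈ Icc (0 : ℝ) 1, ∀ U ∈ 𝓝 (t, h t), ∃ n, (d n, h (d n)) ∈ U := by
  set S : Set (ℝ × ℝ) := (fun t => (t, h t)) '' Icc (0 : ℝ) 1 with hS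
  have : Nonempty S := ⟨⟨(0, h 0), 0, by simp, rfl⟩⟩
  have hu := TopologicalSpace.denseRange_denseSeq S
  have hmem : ∀ x : S, x.1.1 ∈ Icc (0 : ℝ) 1 ∧ x.1 = (x.1.1, h x.1.1) := by
    rintro ⟨_, t, ht, rfl⟩
    exact ⟨ht, rfl⟩
  refine ⟨fun n => (TopologicalSpace.denseSeq S n).1.1, fun n => (hmem _).1, fun t ht U hU => ?_⟩
  have hx : ((↑) : S → ℝ × ℝ) ⁻¹' U ∈ 𝓝 (⟨(t, h t), t, ht, rfl⟩ : S) :=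
    continuous_subtype_val.continuousAt.preimage_mem_nhds hU
  obtain ⟨y, hy1, n, rfl⟩ := mem_closure_iff_nhds.1 (hu _) _ hx
  refine ⟨n, ?_⟩
  rw [← (hmem _).2]
  exact hy1

theorem concaveEnvelope_mono {h' : ℝ → ℝ} {M' : ℝ} (h0' : h' 0 = 0)
    (hM' : ∀ t ∈ Icc (0 : ℝ) 1, h' t ≤ M') (hle : ∀ t ∈ Icc (0 : ℝ) 1, h t ≤ h' t) {t : ℝ}
    (ht : t ∈ Icc (0 : ℝ) 1) : concaveEnvelope h t ≤ concaveEnvelope h' t :=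
  concaveEnvelope_le (concaveOn_concaveEnvelope h0' hM') (concaveEnvelope_zero h0' hM')
    (fun _ hs => concaveEnvelope_le_bound h0' hM' hs)
    (fun s hs => (hle s hs).trans (le_concaveEnvelope h0' hM' hs)) ht

theorem exists_grids_tendsto (h0 : h 0 = 0) (hM : ∀ t ∈ Icc (0 : ℝ) 1, |h t| ≤ M) :
    ∃ G : ℕ → Finset ℝ, (∀ n, IsGrid (G n)) ∧ ∀ t ∈ Icc (0 : ℝ) 1,
      Tendsto (fun n => concaveEnvelope (gridFun h M (G n)) t) atTop (𝓝 (concaveEnvelope h t)) := by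
  classical
  obtain ⟨d, hd01, hd⟩ := exists_graph_dense_seq h
  set G : ℕ → Finset ℝ := fun n => insert 0 (insert 1 ((Finset.range n).image d)) with hGdef
  have hG : ∀ n, IsGrid (G n) := fun n => ⟨by simp [hGdef], by simp [hGdef], fun t ht => by
    simp only [hGdef, Finset.mem_insert, Finset.mem_image, Finset.mem_range] at ht
    rcases ht with rfl | rfl | ⟨i, -, rfl⟩
    · simp
    · simp
    · exact hd01 i⟩
  have hGmono : ∀ {n k : ℕ}, n ≤ k → G n ⊆ G k := fun hnk =>
    Finset.insert_subset_insert _ (Finset.insert_subset_insert _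
      (Finset.image_subset_image (Finset.range_mono hnk)))
  refine ⟨G, hG, ?_⟩
  have hM' : ∀ t ∈ Icc (0 : ℝ) 1, h t ≤ M := fun t ht => (abs_le.1 (hM t ht)).2
  have hn0 : ∀ n, gridFun h M (G n) 0 = 0 := fun n => (gridFun_of_mem (hG n).zero_mem).trans h0
  have hnM : ∀ n, ∀ t ∈ Icc (0 : ℝ) 1, gridFun h M (G n) t ≤ M := fun n t ht =>
    gridFun_le_bound hM ht
  have hle : ∀ n, ∀ t ∈ Icc (0 : ℝ) 1,
      concaveEnvelope (gridFun h M (G n)) t ≤ concaveEnvelope h t := fun n t ht =>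
    concaveEnvelope_mono h0 hM' (fun s hs => gridFun_le hM hs) ht
  have hmono : ∀ t ∈ Icc (0 : ℝ) 1, Monotone fun n => concaveEnvelope (gridFun h M (G n)) t :=
    fun t ht n k hnk => concaveEnvelope_mono (hn0 k) (hnM k)
      (fun s hs => gridFun_mono hM (hGmono hnk) hs) ht
  set L : ℝ → ℝ := fun t => ⨆ n, concaveEnvelope (gridFun h M (G n)) t with hL
  have hbdd : ∀ t ∈ Icc (0 : ℝ) 1,
      BddAbove (range fun n => concaveEnvelope (gridFun h M (G n)) t) := by
    rintro t ht
    refine ⟨concaveEnvelope h t, ?_⟩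
    rintro _ ⟨n, rfl⟩
    exact hle n t ht
  have hlim : ∀ t ∈ Icc (0 : ℝ) 1,
      Tendsto (fun n => concaveEnvelope (gridFun h M (G n)) t) atTop (𝓝 (L t)) := fun t ht =>
    tendsto_atTop_ciSup (hmono t ht) (hbdd t ht)
  have hnL : ∀ n, ∀ t ∈ Icc (0 : ℝ) 1, concaveEnvelope (gridFun h M (G n)) t ≤ L t := fun n t ht =>
    le_ciSup (hbdd t ht) n
  have hLle : ∀ t ∈ Icc (0 : ℝ) 1, L t ≤ concaveEnvelope h t := fun t ht =>
    ciSup_le fun n => hle n t ht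
  have hLc : ConcaveOn ℝ (Icc 0 1) L := by
    refine ⟨convex_Icc 0 1, fun x hx y hy a b ha hb hab => ?_⟩
    exact le_of_tendsto_of_tendsto' (((hlim x hx).const_smul a).add ((hlim y hy).const_smul b))
      (hlim _ ((convex_Icc 0 1) hx hy ha hb hab)) fun n =>
        (concaveOn_concaveEnvelope (hn0 n) (hnM n)).2 hx hy ha hb hab
  have hL0 : L 0 = 0 := by
    simp only [hL, concaveEnvelope_zero (hn0 _) (hnM _), ciSup_const]
  have hL1 : L 1 = h 1 := by
    simp only [hL, concaveEnvelope_one (hn0 _) (hnM _), gridFun_of_mem (hG _).one_mem, ciSup_const]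
  have hhL : ∀ t ∈ Icc (0 : ℝ) 1, h t ≤ L t := by
    intro t ht
    rcases ht.1.eq_or_lt with h' | ht0
    · rw [← h', hL0, h0]
    rcases ht.2.eq_or_lt with h' | ht1
    · rw [h', hL1]
    -- If `L t < y < h t`, continuity of `L` inside and density of the graph give a grid point with
    -- `L < y < h`, although each grid envelope dominates `h` on its grid.
    by_contra hcon
    obtain ⟨y, hy1, hy2⟩ := exists_between (not_le.1 hcon)
    have hct : ContinuousAt L t := by
      have := hLc.continuousOn_interior
      rw [interior_Icc] at this
      exact this.continuousAt (Ioo_mem_nhds ht0 ht1)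
    have hU : {x : ℝ × ℝ | L x.1 < y ∧ y < x.2} ∈ 𝓝 (t, h t) := by
      rw [nhds_prod_eq]
      exact prod_mem_prod (hct.eventually (gt_mem_nhds hy1)) (lt_mem_nhds hy2)
    obtain ⟨n, hn1, hn2⟩ := hd t ht _ hU
    have hmem : d n ∈ G (n + 1) := by
      simp only [hGdef, Finset.mem_insert, Finset.mem_image, Finset.mem_range]
      exact Or.inr (Or.inr ⟨n, Nat.lt_succ_self n, rfl⟩)
    have h1 := le_concaveEnvelope (hn0 (n + 1)) (hnM (n + 1)) (hd01 n)
    rw [gridFun_of_mem hmem] at h1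
    have h2 := hnL (n + 1) _ (hd01 n)
    simp only at hn1 hn2
    linarith
  intro t ht
  have heq : concaveEnvelope h t = L t := le_antisymm
    (concaveEnvelope_le hLc hL0 (fun s hs => (hLle s hs).trans (concaveEnvelope_le_bound h0 hM' hs))
      hhL ht) (hLle t ht)
  rw [heq]
  exact hlim t ht

end approx

/-! ### The value of the supremum and its maximizers -/

section supremum

variable {h : ℝ → ℝ} {M p q c m v : ℝ}

theorem coe_ennreal_eq_coe_toReal {C : ENNReal} (hC : C ≠ ⊤) : (C : EReal) = (C.toReal : ℝ) := by
  rw [← EReal.toReal_coe_ennreal, EReal.coe_toReal]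
  · simpa using hC
  · exact EReal.coe_ennreal_ne_bot C

theorem centralNorm_eq_devNorm {g : ℝ → ℝ} (hg : ContinuousOn g (Icc 0 1))
    (hmin : ∀ x, devNorm g q c ≤ devNorm g q x) : centralNorm g q = devNorm g q c := by
  rw [centralNorm, if_pos hg]
  exact le_antisymm (iInf_le _ _) (le_iInf hmin)

theorem continuousOn_of_centralNorm_ne_top {g : ℝ → ℝ} (hC : centralNorm g q ≠ ⊤) :
    ContinuousOn g (Icc 0 1) := by
  by_contra hcon
  exact hC (if_neg hcon)

theorem iSup_riskmetric (hpq : q.HolderConjugate p) (hv : 0 < v) (h0 : h 0 = 0)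
    (hM : ∀ t ∈ Icc (0 : ℝ) 1, |h t| ≤ M) :
    (⨆ F ∈ admissible h p m v, (riskmetric h F : EReal)) =
      ((m * h 1 : ℝ) : EReal) + (v : EReal) * (centralNorm (concaveEnvelope h) q : EReal) := by
  have hM' : ∀ t ∈ Icc (0 : ℝ) 1, h t ≤ M := fun t ht => (abs_le.1 (hM t ht)).2
  refine le_antisymm (iSup₂_le fun F hF => ?_) ?_
  · rcases eq_or_ne (centralNorm (concaveEnvelope h) q) ⊤ with hC | hC
    · rw [hC, EReal.coe_ennreal_top, EReal.coe_mul_top_of_pos hv, EReal.coe_add_top]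
      exact le_top
    · have hcont := continuousOn_of_centralNorm_ne_top hC
      obtain ⟨c, hc⟩ := exists_devNorm_le (concaveEnvelope h) q hpq.lt.le
      rw [centralNorm_eq_devNorm hcont hc] at hC ⊢
      rw [coe_ennreal_eq_coe_toReal hC]
      exact_mod_cast (riskmetric_le hpq hv h0 hM' hcont hC hF).1
  · obtain ⟨G, hG, hlim⟩ := exists_grids_tendsto h0 hM
    choose c hc using fun n =>
      exists_devNorm_le (concaveEnvelope (gridFun h M (G n))) q hpq.lt.le
    set S := ⨆ F ∈ admissible h p m v, (riskmetric h F : EReal) with hS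
    have hSn : ∀ n, ((m * h 1 + v *
        (devNorm (concaveEnvelope (gridFun h M (G n))) q (c n)).toReal : ℝ) : EReal) ≤ S := by
      intro n
      obtain ⟨F, hF, hFr⟩ := exists_admissible_of_grid (m := m) hpq hv h0 hM (hG n) (hc n)
      rw [← hFr]
      exact le_iSup₂ (f := fun F (_ : F ∈ admissible h p m v) => (riskmetric h F : EReal)) F hF
    -- A finite supremum bounds the central norms of all grid envelopes, hence by lower
    -- semicontinuity that of `concaveEnvelope h`; an infinite central norm thus forces an infinite
    -- supremum.
    rcases eq_or_ne S ⊤ with hT | hT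
    · rw [hT]
      exact le_top
    have hB : S ≠ ⊥ := ne_bot_of_le_ne_bot (EReal.coe_ne_bot _) (hSn 0)
    lift S to ℝ using ⟨hT, hB⟩ with r hr
    have hle : ∀ n, (devNorm (concaveEnvelope (gridFun h M (G n))) q (c n)).toReal ≤
        (r - m * h 1) / v := fun n => by
      rw [le_div_iff₀ hv]
      linarith [EReal.coe_le_coe_iff.1 (hSn n)]
    have hB0 : 0 ≤ (r - m * h 1) / v := ENNReal.toReal_nonneg.trans (hle 0)
    have hn0 : ∀ n, gridFun h M (G n) 0 = 0 := fun n => (gridFun_of_mem (hG n).zero_mem).trans h0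
    have hnM : ∀ n, ∀ t ∈ Icc (0 : ℝ) 1, gridFun h M (G n) t ≤ M := fun n t ht =>
      gridFun_le_bound hM ht
    have hC := centralNorm_le_of_tendsto hpq.lt hB0
      (fun n => concaveOn_concaveEnvelope (hn0 n) (hnM n))
      (fun n t ht => concaveEnvelope_le_bound (hn0 n) (hnM n) ht)
      (fun n => continuousOn_envelope_grid h0 hM (hG n))
      (concaveOn_concaveEnvelope h0 hM') (fun t ht => concaveEnvelope_le_bound h0 hM' ht) hlim
      (c := c) (fun n => by
        rw [← ENNReal.ofReal_toReal (devNorm_envelope_grid_ne_top h0 hM (hG n) (c n))]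
        exact ENNReal.ofReal_le_ofReal (hle n))
    have hCt : centralNorm (concaveEnvelope h) q ≠ ⊤ :=
      ne_top_of_le_ne_top ENNReal.ofReal_ne_top hC
    rw [coe_ennreal_eq_coe_toReal hCt]
    have h1 := ENNReal.toReal_mono ENNReal.ofReal_ne_top hC
    rw [ENNReal.toReal_ofReal hB0, le_div_iff₀ hv] at h1
    have h2 : m * h 1 + v * (centralNorm (concaveEnvelope h) q).toReal ≤ r := by linarith
    exact_mod_cast h2

theorem IsDistortion.exists_abs_le (hh : IsDistortion h) : ∃ M, ∀ t ∈ Icc (0 : ℝ) 1, |h t| ≤ M := by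
  refine ⟨(eVariationOn h (Icc 0 1)).toReal, fun t ht => ?_⟩
  have := hh.1.dist_le ht (y := 0) (by simp)
  rwa [Real.dist_eq, hh.2, sub_zero] at this

theorem IsDistortion.tendsto_leftLim (hh : IsDistortion h) {t : ℝ} (ht : t ∈ Ioo (0 : ℝ) 1) :
    Tendsto h (𝓝[<] t) (𝓝 (Function.leftLim h t)) := by
  obtain ⟨l, hl⟩ := hh.1.exists_tendsto_left t
  have e : 𝓝[Icc 0 1 ∩ Iio t] t = 𝓝[<] t := by
    exact nhdsWithin_inter_of_mem (nhdsWithin_le_nhds (Icc_mem_nhds ht.1 ht.2))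
  rw [e] at hl
  rwa [leftLim_eq_of_tendsto hl]

theorem IsDistortion.tendsto_rightLim (hh : IsDistortion h) {t : ℝ} (ht : t ∈ Ioo (0 : ℝ) 1) :
    Tendsto h (𝓝[>] t) (𝓝 (Function.rightLim h t)) := by
  obtain ⟨l, hl⟩ := hh.1.exists_tendsto_right t
  have e : 𝓝[Icc 0 1 ∩ Ioi t] t = 𝓝[>] t := by
    exact nhdsWithin_inter_of_mem (nhdsWithin_le_nhds (Icc_mem_nhds ht.1 ht.2))
  rw [e] at hl
  rwa [rightLim_eq_of_tendsto hl]

/-- Bounded variation provides the one-sided limits, and equality with `upperMod h` says that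
neither exceeds the value. -/
theorem IsDistortion.usc_of_eqOn_upperMod (hh : IsDistortion h)
    (heq : EqOn h (upperMod h) (Icc 0 1)) {s : ℝ} (hs : s ∈ Ioo (0 : ℝ) 1) {y : ℝ} (hy : h s < y) :
    ∀ᶠ t in 𝓝 s, h t < y := by
  have hlims : Function.rightLim h s ≤ h s ∧ Function.leftLim h s ≤ h s := by
    have h1 := heq (Ioo_subset_Icc_self hs)
    unfold upperMod at h1
    split_ifs at h1 with hj
    · constructor
      · rw [h1]
        exact (le_max_left _ _).trans (le_max_left _ _)
      · rw [h1]
        exact (le_max_right _ _).trans (le_max_left _ _)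
    · by_contra hcon
      refine hj ⟨hs, ?_⟩
      by_contra h2
      push Not at h2
      exact hcon ⟨h2.1.symm.le, h2.2.symm.le⟩
  have hL := (hh.tendsto_leftLim hs).eventually (gt_mem_nhds (hlims.2.trans_lt hy))
  have hR := (hh.tendsto_rightLim hs).eventually (gt_mem_nhds (hlims.1.trans_lt hy))
  rw [← nhdsNE_sup_pure, ← nhdsLT_sup_nhdsGT]
  simp only [eventually_sup, eventually_pure]
  exact ⟨⟨hL, hR⟩, hy⟩

open Classical in
/-- The function `φ` relative to a given center. -/
def phiAt (g : ℝ → ℝ) (q c t : ℝ) : ℝ :=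
  if deriv g (1 - t) - c ≠ 0 then
    |deriv g (1 - t) - c| ^ q / (deriv g (1 - t) - c) * (centralNorm g q).toReal ^ (1 - q)
  else 0

/-- A free center serves the passage to `-g`: `-center g q` is a minimizer there, but without
uniqueness it need not be the chosen one. -/
theorem phi_eq_phiAt (g : ℝ → ℝ) (q t : ℝ) : phi g q t = phiAt g q (center g q) t := by
  unfold phi phiAt
  rfl

theorem ae_unitMeasure_one_sub {P : ℝ → Prop} (hP : ∀ᵐ t ∂unitMeasure, P t) :
    ∀ᵐ t ∂unitMeasure, P (1 - t) := by
  rw [ae_restrict_iff' measurableSet_Ioo] at hP ⊢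
  filter_upwards [(Measure.measurePreserving_sub_left volume (1 : ℝ)).quasiMeasurePreserving.ae hP]
    with t ht h
  exact ht ⟨by linarith [h.2], by linarith [h.1]⟩

theorem attainsSup_iff_of_ne_top (hpq : q.HolderConjugate p) (hv : 0 < v) (h0 : h 0 = 0)
    (hM : ∀ t ∈ Icc (0 : ℝ) 1, |h t| ≤ M) (hC : centralNorm (concaveEnvelope h) q ≠ ⊤)
    (F : Measure ℝ) : AttainsSup h p m v F ↔ F ∈ admissible h p m v ∧
      riskmetric h F = m * h 1 + v * (centralNorm (concaveEnvelope h) q).toReal := by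
  unfold AttainsSup
  rw [iSup_riskmetric hpq hv h0 hM, coe_ennreal_eq_coe_toReal hC]
  norm_cast

theorem exists_attainsSup (hpq : q.HolderConjugate p) (hv : 0 < v) (hh : IsDistortion h)
    (heq : EqOn h (upperMod h) (Icc 0 1)) (hC : centralNorm (concaveEnvelope h) q ≠ ⊤) :
    ∃ F, AttainsSup h p m v F := by
  obtain ⟨M, hM⟩ := hh.exists_abs_le
  have hM' : ∀ t ∈ Icc (0 : ℝ) 1, h t ≤ M := fun t ht => (abs_le.1 (hM t ht)).2
  have hcont := continuousOn_of_centralNorm_ne_top hC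
  obtain ⟨c, hc⟩ := exists_devNorm_le (concaveEnvelope h) q hpq.lt.le
  simp only [attainsSup_iff_of_ne_top hpq hv hh.2 hM hC]
  rw [centralNorm_eq_devNorm hcont hc] at hC ⊢
  obtain ⟨hF, hFf, hFr⟩ := optimal_properties (m := m) (v := v) hpq hv
    (concaveOn_concaveEnvelope hh.2 hM') (fun t ht => concaveEnvelope_le_bound hh.2 hM' ht) hcont
    (concaveEnvelope_zero hh.2 hM') hc hC
  have hcoin := eq_concaveEnvelope_of_optimal (m := m) (c := c) hpq.lt hv hh.2 hM' hcont
    fun s hs y hy => hh.usc_of_eqOn_upperMod heq hs hy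
  have hg1 := concaveEnvelope_one hh.2 hM'
  refine ⟨_, ⟨hF, ?_⟩, ?_⟩
  · unfold RiskmetricFinite at hFf ⊢
    simpa only [hcoin, hg1] using hFf
  · rw [← hg1, ← hFr]
    unfold riskmetric
    simp only [hcoin, hg1]

theorem quantile_of_attainsSup (hpq : q.HolderConjugate p) (hv : 0 < v) (hh : IsDistortion h)
    (hC0 : 0 < centralNorm (concaveEnvelope h) q) (hC : centralNorm (concaveEnvelope h) q ≠ ⊤)
    (hc : ∀ x, devNorm (concaveEnvelope h) q c ≤ devNorm (concaveEnvelope h) q x)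
    {F : Measure ℝ} (hF : AttainsSup h p m v F) :
    ∀ᵐ t ∂unitMeasure, quantile F t = m + v * phiAt (concaveEnvelope h) q c t := by
  obtain ⟨M, hM⟩ := hh.exists_abs_le
  have hM' : ∀ t ∈ Icc (0 : ℝ) 1, h t ≤ M := fun t ht => (abs_le.1 (hM t ht)).2
  have hcont := continuousOn_of_centralNorm_ne_top hC
  rw [attainsSup_iff_of_ne_top hpq hv hh.2 hM hC] at hF
  have hCc := centralNorm_eq_devNorm hcont hc
  have hg := concaveOn_concaveEnvelope hh.2 hM'
  have hgM : ∀ t ∈ Icc (0 : ℝ) 1, concaveEnvelope h t ≤ M := fun t ht =>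
    concaveEnvelope_le_bound hh.2 hM' ht
  have hfin : devNorm (concaveEnvelope h) q c ≠ ⊤ := hCc ▸ hC
  have hpos : 0 < (devNorm (concaveEnvelope h) q c).toReal :=
    hCc ▸ ENNReal.toReal_pos hC0.ne' hC
  have h1 := (riskmetric_le hpq hv hh.2 hM' hcont hfin hF.1).2 hpos (by rw [hF.2, hCc])
  filter_upwards [ae_unitMeasure_one_sub h1,
    ae_unitMeasure_one_sub (deriv_ae_eq_rDeriv hg hgM)] with t ht1 ht2
  rw [sub_sub_cancel] at ht1
  rw [ht1, optimal, phiAt, hCc, toReal_devNorm hpq.lt hg hgM hfin, ht2]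
  congr 2
  split_ifs with hne
  · rw [sPow_eq_div hpq.lt hne]
  · rw [not_not.1 hne]
    simp [sPow]

end supremum

/-! ### Reduction of the infimum to the supremum by changing sign -/

section neg

variable {h g : ℝ → ℝ} {p q m v : ℝ}

theorem IsDistortion.neg (hh : IsDistortion h) : IsDistortion (-h) :=
  ⟨(LipschitzWith.id.neg.lipschitzOnWith (s := univ)).comp_boundedVariationOn
    (mapsTo_univ _ _) hh.1, by simp [hh.2]⟩

theorem concaveEnvelope_neg (h : ℝ → ℝ) : concaveEnvelope (-h) = -convexEnvelope h := by
  ext t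
  rw [Pi.neg_apply, concaveEnvelope, convexEnvelope, ← Real.sInf_neg]
  congr 1
  ext y
  simp only [Set.mem_neg, mem_ofPred_eq]
  constructor
  · rintro ⟨g, hg1, hg2, hg3, rfl⟩
    exact ⟨-g, hg1.neg, fun s hs => by have := hg2 s hs; simp at this ⊢; linarith, hg3.neg, rfl⟩
  · rintro ⟨g, hg1, hg2, hg3, hy⟩
    exact ⟨-g, hg1.neg, fun s hs => by simpa using hg2 s hs, hg3.neg, by simp [← hy]⟩

theorem riskmetric_neg (h : ℝ → ℝ) (F : Measure ℝ) : riskmetric (-h) F = -riskmetric h F := by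
  unfold riskmetric
  have e : ∀ x, (-h) (F.real (Ioi x)) - (-h) 1 = -(h (F.real (Ioi x)) - h 1) := fun x => by
    simp only [Pi.neg_apply]
    ring
  simp only [e]
  simp only [Pi.neg_apply]
  rw [integral_neg, integral_neg]
  ring

theorem admissible_neg (h : ℝ → ℝ) (p m v : ℝ) : admissible (-h) p m v = admissible h p m v := by
  have e : ∀ (F : Measure ℝ) x, (-h) (F.real (Ioi x)) - (-h) 1 = -(h (F.real (Ioi x)) - h 1) :=
    fun F x => by
      simp only [Pi.neg_apply]
      ring
  ext F
  simp only [admissible, RiskmetricFinite, mem_ofPred_eq, e]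
  simp only [Pi.neg_apply, IntegrableOn]
  rw [integrable_fun_neg_iff, integrable_fun_neg_iff]

theorem devNorm_neg (g : ℝ → ℝ) (q x : ℝ) : devNorm (-g) q x = devNorm g q (-x) := by
  unfold devNorm
  rw [← eLpNorm_neg]
  congr 1
  ext t
  simp only [Pi.neg_apply, deriv.neg]
  ring

theorem centralNorm_neg (g : ℝ → ℝ) (q : ℝ) : centralNorm (-g) q = centralNorm g q := by
  unfold centralNorm
  have hc : ContinuousOn (-g) (Icc 0 1) ↔ ContinuousOn g (Icc 0 1) :=
    ⟨fun H => by simpa using H.neg, fun H => H.neg⟩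
  simp only [hc, devNorm_neg]
  have he : ⨅ x, devNorm g q (-x) = ⨅ x, devNorm g q x :=
    (Equiv.neg ℝ).iInf_congr (g := fun x => devNorm g q x) fun x => rfl
  rw [he]
  split_ifs <;> tauto

theorem IsDistortion.leftLim_neg (hh : IsDistortion h) {t : ℝ} (ht : t ∈ Ioo (0 : ℝ) 1) :
    Function.leftLim (-h) t = -Function.leftLim h t :=
  leftLim_eq_of_tendsto (hh.tendsto_leftLim ht).neg

theorem IsDistortion.rightLim_neg (hh : IsDistortion h) {t : ℝ} (ht : t ∈ Ioo (0 : ℝ) 1) :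
    Function.rightLim (-h) t = -Function.rightLim h t :=
  rightLim_eq_of_tendsto (hh.tendsto_rightLim ht).neg

theorem IsDistortion.upperMod_neg (hh : IsDistortion h) : upperMod (-h) = -lowerMod h := by
  have hj : jumpSet (-h) = jumpSet h := by
    ext t
    unfold jumpSet
    simp only [mem_ofPred_eq]
    refine and_congr_right fun ht => ?_
    rw [hh.leftLim_neg ht, hh.rightLim_neg ht]
    simp only [Pi.neg_apply, ne_eq, neg_inj]
  ext t
  rw [Pi.neg_apply, upperMod, lowerMod, hj]
  split_ifs with ht
  · rw [hh.leftLim_neg ht.1, hh.rightLim_neg ht.1, Pi.neg_apply, max_neg_neg, max_neg_neg]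
  · rfl

theorem phiAt_neg (g : ℝ → ℝ) (q c t : ℝ) : phiAt (-g) q (-c) t = -phiAt g q c t := by
  have e : deriv (-g) (1 - t) - -c = -(deriv g (1 - t) - c) := by
    simp only [deriv.neg]
    ring
  unfold phiAt
  rw [e, centralNorm_neg]
  simp only [ne_eq, neg_eq_zero, abs_neg]
  split_ifs
  · simp
  · rw [div_neg, neg_mul]

theorem biInf_eq_neg_biSup {ι : Type*} (S : Set ι) (f : ι → EReal) :
    ⨅ i ∈ S, f i = -⨆ i ∈ S, -f i := by
  refine le_antisymm (EReal.le_neg_of_le_neg (iSup₂_le fun i hi =>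
    EReal.neg_le_neg_iff.2 (iInf₂_le i hi))) (le_iInf₂ fun i hi => EReal.neg_le_of_neg_le ?_)
  exact le_iSup₂ (f := fun i (_ : i ∈ S) => -f i) i hi

theorem iInf_riskmetric_eq (h : ℝ → ℝ) (p m v : ℝ) :
    (⨅ F ∈ admissible h p m v, (riskmetric h F : EReal)) =
      -⨆ F ∈ admissible (-h) p m v, (riskmetric (-h) F : EReal) := by
  rw [biInf_eq_neg_biSup, admissible_neg]
  simp only [riskmetric_neg, EReal.coe_neg]

theorem attainsSup_neg_iff (F : Measure ℝ) : AttainsSup (-h) p m v F ↔ AttainsInf h p m v F := by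
  unfold AttainsSup AttainsInf
  rw [iInf_riskmetric_eq, admissible_neg, riskmetric_neg, EReal.coe_neg, neg_eq_iff_eq_neg]

end neg

end DistortionRiskmetric

end

/-! ### The theorem -/

theorem theorem2 (h : ℝ → ℝ) (hh : DistortionRiskmetric.IsDistortion h)
    (m v p q : ℝ) (hv : 0 < v) (hp : 1 < p) (hpq : 1 / p + 1 / q = 1) :
    ((⨆ F ∈ DistortionRiskmetric.admissible h p m v,
        (DistortionRiskmetric.riskmetric h F : EReal)) =
      ((m * h 1 : ℝ) : EReal) + (v : EReal) *
        ((DistortionRiskmetric.centralNorm (DistortionRiskmetric.concaveEnvelope h) q : ENNReal) :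
          EReal)) ∧
    ((⨅ F ∈ DistortionRiskmetric.admissible h p m v,
        (DistortionRiskmetric.riskmetric h F : EReal)) =
      ((m * h 1 : ℝ) : EReal) - (v : EReal) *
        ((DistortionRiskmetric.centralNorm (DistortionRiskmetric.convexEnvelope h) q : ENNReal) :
          EReal)) ∧
    (EqOn h (DistortionRiskmetric.upperMod h) (Icc 0 1) →
      0 < DistortionRiskmetric.centralNorm (DistortionRiskmetric.concaveEnvelope h) q →
      DistortionRiskmetric.centralNorm (DistortionRiskmetric.concaveEnvelope h) q < ⊤ →
      (∃ F, DistortionRiskmetric.AttainsSup h p m v F) ∧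
      ∀ F, DistortionRiskmetric.AttainsSup h p m v F →
        ∀ᵐ t ∂(volume.restrict (Ioo (0 : ℝ) 1)), DistortionRiskmetric.quantile F t =
          m + v * DistortionRiskmetric.phi (DistortionRiskmetric.concaveEnvelope h) q t) ∧
    (EqOn h (DistortionRiskmetric.lowerMod h) (Icc 0 1) →
      0 < DistortionRiskmetric.centralNorm (DistortionRiskmetric.convexEnvelope h) q →
      DistortionRiskmetric.centralNorm (DistortionRiskmetric.convexEnvelope h) q < ⊤ →
      (∃ F, DistortionRiskmetric.AttainsInf h p m v F) ∧
      ∀ F, DistortionRiskmetric.AttainsInf h p m v F →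
        ∀ᵐ t ∂(volume.restrict (Ioo (0 : ℝ) 1)), DistortionRiskmetric.quantile F t =
          m - v * DistortionRiskmetric.phi (DistortionRiskmetric.convexEnvelope h) q t) := by
  have hq0 : q ≠ 0 := by
    rintro rfl
    rw [div_zero, add_zero, div_eq_one_iff_eq (by linarith)] at hpq
    exact hp.ne hpq
  have hpc : p.HolderConjugate q :=
    Real.holderConjugate_iff.2 ⟨hp, by simpa only [one_div] using hpq⟩
  have hqp : q.HolderConjugate p := hpc.symm
  obtain ⟨M, hM⟩ := hh.exists_abs_le
  have hneg := DistortionRiskmetric.concaveEnvelope_neg h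
  refine ⟨DistortionRiskmetric.iSup_riskmetric hqp hv hh.2 hM, ?_, ?_, ?_⟩
  · obtain ⟨M', hM'⟩ := hh.neg.exists_abs_le
    rw [DistortionRiskmetric.iInf_riskmetric_eq,
      DistortionRiskmetric.iSup_riskmetric hqp hv hh.neg.2 hM', hneg,
      DistortionRiskmetric.centralNorm_neg, EReal.neg_add (Or.inl (EReal.coe_ne_bot _))
        (Or.inl (EReal.coe_ne_top _)), ← EReal.coe_neg]
    congr 2
    simp
  · intro heq hpos hfin
    refine ⟨DistortionRiskmetric.exists_attainsSup hqp hv hh heq hfin.ne, fun F hF => ?_⟩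
    obtain hc := Classical.epsilon_spec (DistortionRiskmetric.exists_devNorm_le
      (DistortionRiskmetric.concaveEnvelope h) q hqp.lt.le)
    exact (DistortionRiskmetric.quantile_of_attainsSup hqp hv hh hpos hfin.ne hc hF).mono
      fun t ht => by rw [ht, DistortionRiskmetric.phi_eq_phiAt]; rfl
  · intro heq hpos hfin
    have heq' : EqOn (-h) (DistortionRiskmetric.upperMod (-h)) (Icc 0 1) := fun t ht => by
      rw [hh.upperMod_neg, Pi.neg_apply, Pi.neg_apply, ← heq ht]
    have hC : DistortionRiskmetric.centralNorm (DistortionRiskmetric.concaveEnvelope (-h)) q =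
        DistortionRiskmetric.centralNorm (DistortionRiskmetric.convexEnvelope h) q := by
      rw [hneg, DistortionRiskmetric.centralNorm_neg]
    rw [← hC] at hpos hfin
    simp only [← DistortionRiskmetric.attainsSup_neg_iff]
    refine ⟨DistortionRiskmetric.exists_attainsSup hqp hv hh.neg heq' hfin.ne, fun F hF => ?_⟩
    have hc := Classical.epsilon_spec (DistortionRiskmetric.exists_devNorm_le
      (DistortionRiskmetric.convexEnvelope h) q hqp.lt.le)
    -- Negating a function carries minimizers of the deviation norm to their negatives.
    have hc' : ∀ x, DistortionRiskmetric.devNorm (DistortionRiskmetric.concaveEnvelope (-h)) q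
        (-DistortionRiskmetric.center (DistortionRiskmetric.convexEnvelope h) q) ≤
        DistortionRiskmetric.devNorm (DistortionRiskmetric.concaveEnvelope (-h)) q x := fun x => by
      rw [hneg, DistortionRiskmetric.devNorm_neg, DistortionRiskmetric.devNorm_neg, neg_neg]
      exact hc (-x)
    refine (DistortionRiskmetric.quantile_of_attainsSup hqp hv hh.neg hpos hfin.ne hc' hF).mono
      fun t ht => ?_
    rw [ht, hneg, DistortionRiskmetric.phiAt_neg, DistortionRiskmetric.phi_eq_phiAt]
    ring
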